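/- **Setting.** Let $V$ be a vertex set, $w:V\times V\to[0,\infty)$ a symmetric weight function with $w(v,v)=0$ and $\sum_{v'\in V}w(v,v')<\infty$ for all $v\in V$, and $Q:V\to\mathbb{R}$ a potential. Assume that $\Gamma=(w,Q)$ is a crystal of dimension $d\ge 1$: the graph with edges $\{(v,v'):w(v,v')>0\}$ is connected, and $\mathbb{Z}^d$ acts freely on $V$, with finitely many orbits, such that $w(v+k,v'+k)=w(v,v')$ and $Q(v+k)=Q(v)$ for all $v,v'\in V$, $k\in\mathbb{Z}^d$ (where $v+k$ denotes the action of $k$ on $v$). Let $\{v_1,\dots,v_\nu\}$ be a fundamental cell, i.e. every vertex can be written in exactly one way as $v_i+k$ with $1\le i\le\nu$, $k\in\mathbb{Z}^d$. The Schrödinger operator on $\ell^2(V)$ is $$(\mathcal{H}_\Gamma\psi)(v)=\sum_{v'\in V}w(v,v')\,\psi(v')+Q(v)\,\psi(v).$$ For $\theta\in\mathbb{T}^d=\mathbb{R}^d/\mathbb{Z}^d$ let $E_1(\theta)\le\dots\le E_\nu(\theta)$ be the eigenvalues, counted with multiplicity, of the Hermitian $\nu\times\nu$ Floquet matrix $H(\theta)$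 with entries $$h_{ij}(\theta)=\sum_{k\in\mathbb{Z}^d}w(v_i,v_j+k)\,e^{2\pi\mathrm{i}\,\theta\cdot k}+\delta_{ij}\,Q(v_i).$$ **Theorem 5.3.** Suppose that each of the functions $E_1,\dots,E_\nu$ is Lipschitz continuous on $\mathbb{T}^d$. 1. If, for each $j$, $\nabla E_j\ne 0$ almost everywhere on $\mathbb{T}^d$, then $\mathcal{H}_\Gamma$ has purely absolutely continuous spectrum: it is a bounded self-adjoint operator, and for every $\psi\in\ell^2(V)$ its spectral measure at $\psi$ is absolutely continuous with respect to Lebesgue measure. 2. If, for some $j$, $\nabla E_j=0$ (at almost every point) on some nonempty open set $S\subset\mathbb{T}^d$, then $\mathcal{H}_\Gamma$ has an eigenvalue of infinite multiplicity. -/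

import Mathlib

open MeasureTheory Set
open scoped InnerProductSpace BoundedContinuousFunction

noncomputable section

/-- A weighted graph with a potential over the vertex set `V`: symmetric, nonnegative edge weights
`w` without loops which are summable at each vertex, and a real potential `Q`. -/
structure WeightedGraph (V : Type*) where
  w : V → V → ℝ
  Q : V → ℝ
  w_nonneg : ∀ v v', 0 ≤ w v v'
  w_symm : ∀ v v', w v v' = w v' v
  w_self : ∀ v, w v v = 0
  w_summable : ∀ v, Summable (w v)

/-- The Hilbert space `ℓ²(V)` of complex-valued square summable functions. -/
abbrev EllTwo (V : Type*) : Type _ := lp (fun _ : V => ℂ) 2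

namespace WeightedGraph

variable {V : Type*}

/-- The underlying simple graph: `v ∼ v'` iff `w(v,v') > 0`. -/
def toSimpleGraph (Γ : WeightedGraph V) : SimpleGraph V where
  Adj v v' := 0 < Γ.w v v'
  symm := ⟨fun v v' h => by rw [Γ.w_symm]; exact h⟩
  loopless := ⟨fun v h => by rw [Γ.w_self] at h; exact lt_irrefl _ h⟩

/-- `Γ` is a crystal of dimension `d ≥ 1`: it is connected, and `ℤ^d` acts freely on the vertices,
with finite quotient, leaving the weights and the potential invariant. -/
structure IsCrystal (d : ℕ) [AddAction (Fin d → ℤ) V] (Γ : WeightedGraph V) : Prop where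
  dim_pos : 0 < d
  connected : Γ.toSimpleGraph.Connected
  free : ∀ (k : Fin d → ℤ) (v : V), k +ᵥ v = v → k = 0
  finite_quotient : Finite (AddAction.orbitRel.Quotient (Fin d → ℤ) V)
  w_inv : ∀ (k : Fin d → ℤ) (v v' : V), Γ.w (k +ᵥ v) (k +ᵥ v') = Γ.w v v'
  Q_inv : ∀ (k : Fin d → ℤ) (v : V), Γ.Q (k +ᵥ v) = Γ.Q v

/-- `v 0, …, v (ν - 1)` enumerates a fundamental cell: every vertex is, in exactly one way, a
translate `k + v i` with `k ∈ ℤ^d`. -/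
def IsFundamentalCell {d ν : ℕ} [AddAction (Fin d → ℤ) V] (v : Fin ν → V) : Prop :=
  Function.Bijective fun p : Fin ν × (Fin d → ℤ) => p.2 +ᵥ v p.1

variable {d : ℕ} [AddAction (Fin d → ℤ) V] {Γ : WeightedGraph V}

/-- A `ℤ^d`-invariant real function with finite quotient is bounded. -/
theorem IsCrystal.exists_bound (hΓ : Γ.IsCrystal d) (f : V → ℝ)
    (hf : ∀ (k : Fin d → ℤ) (v : V), f (k +ᵥ v) = f v) : ∃ R : ℝ, 0 ≤ R ∧ ∀ v, |f v| ≤ R := by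
  have := hΓ.finite_quotient
  let F : AddAction.orbitRel.Quotient (Fin d → ℤ) V → ℝ := fun q =>
    Quotient.liftOn q (fun v => |f v|) (by
      rintro a b ⟨k, rfl⟩
      simp [hf])
  obtain ⟨R, hR⟩ := (Set.finite_range F).bddAbove
  have h : ∀ v, |f v| ≤ R := fun v => hR ⟨Quotient.mk _ v, rfl⟩
  obtain ⟨v⟩ := hΓ.connected.nonempty
  exact ⟨R, (abs_nonneg _).trans (h v), h⟩

theorem IsCrystal.exists_degree_bound (hΓ : Γ.IsCrystal d) :
    ∃ R : ℝ, 0 ≤ R ∧ ∀ v, ∑' v', Γ.w v v' ≤ R := by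
  obtain ⟨R, h0, hR⟩ := hΓ.exists_bound (fun v => ∑' v', Γ.w v v') (by
    intro k v
    rw [← (AddAction.toPerm k).tsum_eq]
    simp [hΓ.w_inv])
  exact ⟨R, h0, fun v => (le_abs_self _).trans (hR v)⟩

theorem summable_w_mul (Γ : WeightedGraph V) (ψ : EllTwo V) (v : V) :
    Summable fun v' => (Γ.w v v' : ℂ) * ψ v' := by
  refine Summable.of_norm_bounded ((Γ.w_summable v).mul_right ‖ψ‖) fun v' => ?_
  rw [norm_mul, Complex.norm_real, Real.norm_of_nonneg (Γ.w_nonneg v v')]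
  exact mul_le_mul_of_nonneg_left (lp.norm_apply_le_norm two_ne_zero ψ v') (Γ.w_nonneg v v')

/-- Schur's test for the adjacency matrix. -/
theorem sum_sq_adjacency_le (Γ : WeightedGraph V) {R : ℝ} (hR0 : 0 ≤ R)
    (hR : ∀ v, ∑' v', Γ.w v v' ≤ R) (ψ : EllTwo V) (s : Finset V) :
    ∑ v ∈ s, ‖∑' v', (Γ.w v v' : ℂ) * ψ v'‖ ^ 2 ≤ (R * ‖ψ‖) ^ 2 := by
  have hψ : HasSum (fun v' => ‖ψ v'‖ ^ 2) (‖ψ‖ ^ 2) := by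
    simpa using lp.hasSum_norm (p := 2) (by norm_num) ψ
  have hs2 : ∀ v, Summable fun v' => Γ.w v v' * ‖ψ v'‖ ^ 2 := fun v => by
    refine Summable.of_nonneg_of_le (fun v' => mul_nonneg (Γ.w_nonneg v v') (sq_nonneg _))
      (fun v' => ?_) ((Γ.w_summable v).mul_right (‖ψ‖ ^ 2))
    exact mul_le_mul_of_nonneg_left (pow_le_pow_left₀ (norm_nonneg _)
      (lp.norm_apply_le_norm two_ne_zero ψ v') 2) (Γ.w_nonneg v v')
  have h1 : ∀ v, ‖∑' v', (Γ.w v v' : ℂ) * ψ v'‖ ^ 2 ≤ R * ∑' v', Γ.w v v' * ‖ψ v'‖ ^ 2 := by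
    intro v
    have hn : ∀ v', ‖(Γ.w v v' : ℂ) * ψ v'‖ = Γ.w v v' * ‖ψ v'‖ := fun v' => by
      rw [norm_mul, Complex.norm_real, Real.norm_of_nonneg (Γ.w_nonneg v v')]
    have ha : ‖∑' v', (Γ.w v v' : ℂ) * ψ v'‖ ≤ ∑' v', Γ.w v v' * ‖ψ v'‖ := by
      refine (norm_tsum_le_tsum_norm (Γ.summable_w_mul ψ v).norm).trans (le_of_eq ?_)
      exact tsum_congr hn
    have hw : Summable fun v' => √(Γ.w v v') ^ (2 : ℝ) :=
      (Γ.w_summable v).congr fun v' => by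
        rw [Real.rpow_two, Real.sq_sqrt (Γ.w_nonneg v v')]
    have hg : Summable fun v' => (√(Γ.w v v') * ‖ψ v'‖) ^ (2 : ℝ) :=
      (hs2 v).congr fun v' => by
        rw [Real.rpow_two, mul_pow, Real.sq_sqrt (Γ.w_nonneg v v')]
    have hcs := Real.inner_le_Lp_mul_Lq_tsum_of_nonneg (p := 2) (q := 2)
      Real.HolderConjugate.two_two
      (fun v' => Real.sqrt_nonneg (Γ.w v v'))
      (fun v' => mul_nonneg (Real.sqrt_nonneg (Γ.w v v')) (norm_nonneg (ψ v'))) hw hg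
    have e1 : ∀ v', √(Γ.w v v') * (√(Γ.w v v') * ‖ψ v'‖) = Γ.w v v' * ‖ψ v'‖ := fun v' => by
      rw [← mul_assoc, Real.mul_self_sqrt (Γ.w_nonneg v v')]
    have e2 : ∀ v', √(Γ.w v v') ^ (2 : ℝ) = Γ.w v v' := fun v' => by
      rw [Real.rpow_two, Real.sq_sqrt (Γ.w_nonneg v v')]
    have e3 : ∀ v', (√(Γ.w v v') * ‖ψ v'‖) ^ (2 : ℝ) = Γ.w v v' * ‖ψ v'‖ ^ 2 := fun v' => by
      rw [Real.rpow_two, mul_pow, Real.sq_sqrt (Γ.w_nonneg v v')]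
    simp only [e1, e2, e3, ← Real.sqrt_eq_rpow] at hcs
    have hB : 0 ≤ ∑' v', Γ.w v v' * ‖ψ v'‖ ^ 2 :=
      tsum_nonneg fun v' => mul_nonneg (Γ.w_nonneg v v') (sq_nonneg _)
    have hA : 0 ≤ ∑' v', Γ.w v v' := tsum_nonneg fun v' => Γ.w_nonneg v v'
    calc ‖∑' v', (Γ.w v v' : ℂ) * ψ v'‖ ^ 2
        ≤ (√(∑' v', Γ.w v v') * √(∑' v', Γ.w v v' * ‖ψ v'‖ ^ 2)) ^ 2 :=
          pow_le_pow_left₀ (norm_nonneg _) (ha.trans hcs) 2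
      _ = (∑' v', Γ.w v v') * ∑' v', Γ.w v v' * ‖ψ v'‖ ^ 2 := by
          rw [mul_pow, Real.sq_sqrt hA, Real.sq_sqrt hB]
      _ ≤ R * ∑' v', Γ.w v v' * ‖ψ v'‖ ^ 2 := mul_le_mul_of_nonneg_right (hR v) hB
  have h2 : ∑ v ∈ s, ∑' v', Γ.w v v' * ‖ψ v'‖ ^ 2 ≤ R * ‖ψ‖ ^ 2 := by
    rw [← Summable.tsum_finsetSum fun v _ => hs2 v, ← hψ.tsum_eq, ← tsum_mul_left]
    refine Summable.tsum_le_tsum (fun v' => ?_) (summable_sum fun v _ => hs2 v)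
      (hψ.summable.mul_left R)
    rw [← Finset.sum_mul]
    refine mul_le_mul_of_nonneg_right ?_ (sq_nonneg _)
    simp only [Γ.w_symm _ v']
    exact ((Γ.w_summable v').sum_le_tsum s fun v _ => Γ.w_nonneg v' v).trans (hR v')
  calc ∑ v ∈ s, ‖∑' v', (Γ.w v v' : ℂ) * ψ v'‖ ^ 2
      ≤ ∑ v ∈ s, R * ∑' v', Γ.w v v' * ‖ψ v'‖ ^ 2 := Finset.sum_le_sum fun v _ => h1 v
    _ = R * ∑ v ∈ s, ∑' v', Γ.w v v' * ‖ψ v'‖ ^ 2 := by rw [Finset.mul_sum]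
    _ ≤ R * (R * ‖ψ‖ ^ 2) := mul_le_mul_of_nonneg_left h2 hR0
    _ = (R * ‖ψ‖) ^ 2 := by ring

theorem sum_sq_potential_le {R : ℝ} (hR : ∀ v, |Γ.Q v| ≤ R) (ψ : EllTwo V) (s : Finset V) :
    ∑ v ∈ s, ‖(Γ.Q v : ℂ) * ψ v‖ ^ 2 ≤ (R * ‖ψ‖) ^ 2 := by
  have hψ : HasSum (fun v' => ‖ψ v'‖ ^ 2) (‖ψ‖ ^ 2) := by
    simpa using lp.hasSum_norm (p := 2) (by norm_num) ψ
  calc ∑ v ∈ s, ‖(Γ.Q v : ℂ) * ψ v‖ ^ 2 ≤ ∑ v ∈ s, R ^ 2 * ‖ψ v‖ ^ 2 := by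
        refine Finset.sum_le_sum fun v _ => ?_
        rw [norm_mul, Complex.norm_real, mul_pow]
        exact mul_le_mul_of_nonneg_right (pow_le_pow_left₀ (norm_nonneg _) (hR v) 2) (sq_nonneg _)
    _ = R ^ 2 * ∑ v ∈ s, ‖ψ v‖ ^ 2 := by rw [Finset.mul_sum]
    _ ≤ R ^ 2 * ‖ψ‖ ^ 2 := mul_le_mul_of_nonneg_left
        (by rw [← hψ.tsum_eq]; exact hψ.summable.sum_le_tsum s fun v _ => sq_nonneg _)
        (sq_nonneg _)
    _ = (R * ‖ψ‖) ^ 2 := by ring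

/-- The adjacency operator `(𝒜 ψ)(v) = ∑_{v'} w(v,v') ψ(v')` on `ℓ²(V)`. -/
def adjacencyOp (hΓ : Γ.IsCrystal d) : EllTwo V →L[ℂ] EllTwo V :=
  LinearMap.mkContinuousOfExistsBound
    { toFun := fun ψ => ⟨fun v => ∑' v', (Γ.w v v' : ℂ) * ψ v', by
        obtain ⟨R, h0, hR⟩ := hΓ.exists_degree_bound
        exact memℓp_gen' (C := (R * ‖ψ‖) ^ 2) fun s => by
          simpa using Γ.sum_sq_adjacency_le h0 hR ψ s⟩
      map_add' := fun ψ φ => by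
        ext v
        simp only [lp.coeFn_add, Pi.add_apply, mul_add]
        exact (Γ.summable_w_mul ψ v).tsum_add (Γ.summable_w_mul φ v)
      map_smul' := fun c ψ => by
        ext v
        simp only [lp.coeFn_smul, Pi.smul_apply, smul_eq_mul, RingHom.id_apply,
          mul_left_comm _ c, tsum_mul_left] }
    (by
      obtain ⟨R, h0, hR⟩ := hΓ.exists_degree_bound
      refine ⟨R, fun ψ => lp.norm_le_of_forall_sum_le (by norm_num)
        (mul_nonneg h0 (norm_nonneg _)) fun s => ?_⟩
      simpa using Γ.sum_sq_adjacency_le h0 hR ψ s)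

/-- The multiplication operator `(Q ψ)(v) = Q(v) ψ(v)` on `ℓ²(V)`. -/
def potentialOp (hΓ : Γ.IsCrystal d) : EllTwo V →L[ℂ] EllTwo V :=
  LinearMap.mkContinuousOfExistsBound
    { toFun := fun ψ => ⟨fun v => (Γ.Q v : ℂ) * ψ v, by
        obtain ⟨R, h0, hR⟩ := hΓ.exists_bound Γ.Q hΓ.Q_inv
        exact memℓp_gen' (C := (R * ‖ψ‖) ^ 2) fun s => by
          simpa using sum_sq_potential_le hR ψ s⟩
      map_add' := fun ψ φ => by
        ext v
        exact mul_add _ _ _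
      map_smul' := fun c ψ => by
        ext v
        simp [mul_left_comm] }
    (by
      obtain ⟨R, h0, hR⟩ := hΓ.exists_bound Γ.Q hΓ.Q_inv
      refine ⟨R, fun ψ => lp.norm_le_of_forall_sum_le (by norm_num)
        (mul_nonneg h0 (norm_nonneg _)) fun s => ?_⟩
      simpa using sum_sq_potential_le hR ψ s)

/-- The Schrödinger operator `ℋ = 𝒜 + Q` on `ℓ²(V)`. -/
def schrodingerOp (hΓ : Γ.IsCrystal d) : EllTwo V →L[ℂ] EllTwo V :=
  adjacencyOp hΓ + potentialOp hΓ

/-- The Floquet matrix `H(θ)`, with entries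
`h_ij(θ) = ∑_{k ∈ ℤ^d} w(v_i, v_j + k) exp(2πi θ·k) + δ_ij Q(v_i)`. -/
def floquetMatrix {ν : ℕ} (Γ : WeightedGraph V) (v : Fin ν → V)
    (θ : EuclideanSpace ℝ (Fin d)) : Matrix (Fin ν) (Fin ν) ℂ :=
  Matrix.of fun i j =>
    (∑' k : Fin d → ℤ, (Γ.w (v i) (k +ᵥ v j) : ℂ) *
      Complex.exp (2 * Real.pi * Complex.I * ((∑ l, θ l * k l : ℝ) : ℂ))) +
    if i = j then (Γ.Q (v i) : ℂ) else 0

theorem floquetMatrix_isHermitian {ν : ℕ} (hΓ : Γ.IsCrystal d) (v : Fin ν → V)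
    (θ : EuclideanSpace ℝ (Fin d)) : (Γ.floquetMatrix v θ).IsHermitian := by
  ext i j
  have hw : ∀ k : Fin d → ℤ, Γ.w (v j) (-k +ᵥ v i) = Γ.w (v i) (k +ᵥ v j) := fun k => by
    rw [← hΓ.w_inv k, vadd_vadd, add_neg_cancel, zero_vadd, Γ.w_symm]
  simp only [floquetMatrix, Matrix.conjTranspose_apply, Matrix.of_apply, star_add]
  congr 1
  · rw [← (Equiv.neg (Fin d → ℤ)).tsum_eq, ← starRingEnd_apply, Complex.conj_tsum]
    refine tsum_congr fun k => ?_
    simp only [Equiv.neg_apply, hw, map_mul, Complex.conj_ofReal, ← Complex.exp_conj,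
      Complex.conj_I]
    congr 2
    simp [Complex.conj_ofNat]
  · by_cases h : i = j
    · subst h; simp
    · simp [h, Ne.symm h]

/-- The Floquet eigenvalue functions `E_0(θ) ≤ … ≤ E_{ν-1}(θ)`: the eigenvalues of `H(θ)` in
increasing order, with multiplicity, as `ℤ^d`-periodic functions of `θ ∈ ℝ^d` (that is, as functions
on the torus `ℝ^d / ℤ^d`). Mathlib's `eigenvalues₀` lists them in decreasing order. -/
def floquetEigenvalue {ν : ℕ} (hΓ : Γ.IsCrystal d) (v : Fin ν → V) (j : Fin ν)
    (θ : EuclideanSpace ℝ (Fin d)) : ℝ :=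
  (floquetMatrix_isHermitian hΓ v θ).eigenvalues₀
    (Fin.cast (Fintype.card_fin ν).symm (Fin.rev j))

end WeightedGraph

section SpectralNotions

variable {E : Type*} [NormedAddCommGroup E] [InnerProductSpace ℂ E] [CompleteSpace E]

/-- `μ` is the spectral measure of the (self-adjoint) operator `T` at `ψ`: the finite Borel measure
on `ℝ` with `⟨ψ, f(T) ψ⟩ = ∫ f dμ` for all bounded continuous `f`, where `f(T)` is given by the
continuous functional calculus. -/
def IsSpectralMeasure (T : E →L[ℂ] E) (ψ : E) (μ : Measure ℝ) : Prop :=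
  IsFiniteMeasure μ ∧ ∀ f : ℝ →ᵇ ℝ, ⟪ψ, cfc (f : ℝ → ℝ) T ψ⟫_ℂ = ((∫ x, f x ∂μ : ℝ) : ℂ)

/-- `T` is self-adjoint with purely absolutely continuous spectrum: every vector has a spectral
measure which is absolutely continuous with respect to Lebesgue measure. -/
def HasPurelyACSpectrum (T : E →L[ℂ] E) : Prop :=
  IsSelfAdjoint T ∧ ∀ ψ : E, ∃ μ : Measure ℝ, IsSpectralMeasure T ψ μ ∧ μ ≪ volume

/-- The real number `lam` is an infinitely degenerate eigenvalue of `T`. -/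
def IsInfinitelyDegenerateEigenvalue (T : E →L[ℂ] E) (lam : ℝ) : Prop :=
  Module.End.HasEigenvalue (T : E →ₗ[ℂ] E) (lam : ℂ) ∧
    ¬ FiniteDimensional ℂ (Module.End.eigenspace (T : E →ₗ[ℂ] E) (lam : ℂ))

end SpectralNotions

end

/-! The Bloch transform turns $\mathcal{H}_\Gamma$ into multiplication by $H(\theta)$. Only a trace
identity is extracted from this, so no eigenvectors depending on $\theta$ have to be chosen. The
spectral measures at the deltas of a fundamental cell add up to the sum over $j$ of the laws of
$E_j$ under Lebesgue measure on a unit cell of the dual torus (`sum_spectralMeasure_single`). The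
moments of both sides agree, because Fourier inversion recovers the diagonal entries of
$\mathcal{H}^n$ from those of $H(\theta)^n$; Weierstrass approximation does the rest.

For absolute continuity, an $E_j$ with nonzero gradient almost everywhere pulls null sets back to
null sets (`volume_preimage_eq_zero_of_ae_gradient_ne_zero`), so the laws are absolutely continuous.
Each spectral measure is dominated by the sum, every vertex lies in a cell, and the vectors with
absolutely continuous spectral measure form a closed subspace.

For a flat band, a Lipschitz $E_j$ with zero gradient on an open set is constant on a ball
(`eq_of_ae_gradient_eq_zero`). Its value is an atom of some spectral measure, and atoms are
eigenvalues by the mean ergodic theorem (`IsSpectralMeasure.exists_apply_eq_smul`). A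
finite-dimensional eigenspace would be invariant under translations and so contain an eigenvector of
a translation, which cannot be square summable. -/

open MeasureTheory Set
open scoped InnerProductSpace BoundedContinuousFunction

noncomputable section

/-! ### Comparison of measures, and functions with nonzero or zero gradient -/

section RealAnalysis

open Filter Topology

/-- A finite measure whose integrals against nonnegative bounded continuous functions are dominated
by those of another finite measure is dominated by it. -/
theorem measure_le_of_forall_integral_le {μ ν : Measure ℝ} [IsFiniteMeasure μ] [IsFiniteMeasure ν]
    (h : ∀ f : ℝ →ᵇ ℝ, 0 ≤ f → ∫ x, f x ∂μ ≤ ∫ x, f x ∂ν) : μ ≤ ν := by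
  have key : ∀ F : Set ℝ, IsClosed F → μ F ≤ ν F := by
    intro F hF
    refine le_of_tendsto_of_tendsto (HasOuterApproxClosed.tendsto_lintegral_apprSeq hF μ)
      (HasOuterApproxClosed.tendsto_lintegral_apprSeq hF ν) (Eventually.of_forall fun n => ?_)
    have h1 := h ((hF.apprSeq n).comp _ NNReal.isometry_coe.lipschitz) (fun x => NNReal.coe_nonneg _)
    simp only [BoundedContinuousFunction.comp_apply] at h1
    rw [← BoundedContinuousFunction.toReal_lintegral_coe_eq_integral,
      ← BoundedContinuousFunction.toReal_lintegral_coe_eq_integral] at h1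
    exact (ENNReal.toReal_le_toReal
      (BoundedContinuousFunction.lintegral_lt_top_of_nnreal _ _).ne
      (BoundedContinuousFunction.lintegral_lt_top_of_nnreal _ _).ne).1 h1
  refine Measure.le_intro fun s hs _ => le_of_forall_lt fun r hr => ?_
  obtain ⟨F, hFs, hF, hr⟩ := hs.exists_lt_isClosed_of_ne_top (measure_ne_top μ s) hr
  exact hr.trans_le ((key F hF).trans (measure_mono hFs))

/-- The preimage of a null set is null within the set where the derivative does not vanish. -/
theorem volume_preimage_inter_deriv_ne_zero {N : Set ℝ} (hN : volume N = 0) (g : ℝ → ℝ) :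
    volume {t | g t ∈ N ∧ ∃ g', g' ≠ 0 ∧ HasDerivAt g g' t} = 0 := by
  set A := {t | g t ∈ N ∧ ∃ g', g' ≠ 0 ∧ HasDerivAt g g' t}
  -- Where the derivative is nonzero, `g` expands distances by a definite factor at some scale. On a
  -- piece of `B n` of diameter below `1 / (n + 1)`, `g` is injective with `n`-Lipschitz inverse, so
  -- the piece is a Lipschitz image of a subset of `N`.
  let B : ℕ → Set ℝ := fun n =>
    {t | g t ∈ N ∧ ∀ s, dist s t < 1 / (n + 1 : ℝ) → dist s t ≤ n * dist (g s) (g t)}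
  have hAB : A ⊆ ⋃ n, B n := by
    rintro t ⟨htN, g', hg', hd⟩
    obtain ⟨C, hC⟩ := (HasDerivAtFilter.isTheta_sub hd hg').2.bound
    rw [prod_pure, eventually_map] at hC
    obtain ⟨ε, hε, hb⟩ := Metric.eventually_nhds_iff.1 hC
    obtain ⟨n1, hn1⟩ := exists_nat_one_div_lt hε
    obtain ⟨n2, hn2⟩ := exists_nat_ge C
    refine mem_iUnion.2 ⟨max n1 n2, htN, fun s hs => ?_⟩
    have h1 : (1 : ℝ) / ((max n1 n2 : ℕ) + 1) ≤ 1 / (n1 + 1) :=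
      one_div_le_one_div_of_le (by positivity) (by push_cast; gcongr; exact le_max_left _ _)
    have h2 := hb (hs.trans (h1.trans_lt hn1))
    rw [dist_eq_norm, dist_eq_norm]
    refine h2.trans (mul_le_mul_of_nonneg_right (hn2.trans ?_) (norm_nonneg _))
    exact_mod_cast le_max_right _ _
  refine measure_mono_null hAB (measure_iUnion_null fun n => ?_)
  refine measure_null_of_locally_null _ fun t _ => ?_
  have hpos : (0 : ℝ) < 1 / (n + 1 : ℝ) / 2 := by positivity
  refine ⟨B n ∩ Metric.ball t (1 / (n + 1 : ℝ) / 2),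
    inter_mem_nhdsWithin _ (Metric.ball_mem_nhds t hpos), ?_⟩
  set u := B n ∩ Metric.ball t (1 / (n + 1 : ℝ) / 2) with hu
  have hanti : ∀ x ∈ u, ∀ y ∈ u, dist x y ≤ n * dist (g x) (g y) := by
    intro x hx y hy
    refine hy.1.2 x ?_
    calc dist x y ≤ dist x t + dist y t := dist_triangle_right _ _ _
      _ < 1 / (n + 1 : ℝ) / 2 + 1 / (n + 1 : ℝ) / 2 := add_lt_add hx.2 hy.2
      _ = _ := by ring
  have hinj : InjOn g u := fun x hx y hy hxy => by
    have := hanti x hx y hy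
    rw [hxy, dist_self, mul_zero] at this
    exact dist_le_zero.1 this
  have hlip : LipschitzOnWith (n : NNReal) (Function.invFunOn g u) (g '' u) := by
    refine LipschitzOnWith.of_dist_le_mul ?_
    rintro _ ⟨x, hx, rfl⟩ _ ⟨y, hy, rfl⟩
    rw [hinj.leftInvOn_invFunOn hx, hinj.leftInvOn_invFunOn hy]
    exact_mod_cast hanti x hx y hy
  have himg : Function.invFunOn g u '' (g '' u) = u := hinj.leftInvOn_invFunOn.image_image
  have hnull : volume (g '' u) = 0 := measure_mono_null (by rintro _ ⟨x, hx, rfl⟩; exact hx.1.1) hN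
  have := hlip.hausdorffMeasure_image_le zero_le_one
  rw [himg, hausdorffMeasure_real, hnull, mul_zero] at this
  exact le_antisymm this zero_le

/-- A continuous function whose gradient is almost everywhere nonzero pulls null sets back to null
sets. -/
theorem volume_preimage_eq_zero_of_ae_gradient_ne_zero {d : ℕ} {E : EuclideanSpace ℝ (Fin d) → ℝ}
    (hE : Continuous E)
    (hgrad : ∀ᵐ θ, ∃ g : EuclideanSpace ℝ (Fin d), g ≠ 0 ∧ HasGradientAt E g θ)
    {N : Set ℝ} (hN : volume N = 0) : volume (E ⁻¹' N) = 0 := by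
  wlog hNm : MeasurableSet N generalizing N
  · exact measure_mono_null (preimage_mono (subset_toMeasurable volume N))
      (this (by rwa [measure_toMeasurable]) (measurableSet_toMeasurable _ _))
  -- By Fubini over the lines in direction `e`, the one-variable lemma is enough.
  have hline : ∀ e : EuclideanSpace ℝ (Fin d), ∀ᵐ θ, E θ ∈ N → fderiv ℝ E θ e = 0 := by
    intro e
    have hs : MeasurableSet {θ | E θ ∈ N → fderiv ℝ E θ e = 0} :=
      (hE.measurable hNm).imp
        (measurableSet_eq_fun (measurable_fderiv_apply_const ℝ E e) measurable_const)
    let L : ℝ →L[ℝ] EuclideanSpace ℝ (Fin d) := ContinuousLinearMap.smulRight (1 : ℝ →L[ℝ] ℝ) e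
    refine ae_mem_of_ae_add_linearMap_mem L.toLinearMap volume volume hs fun y => ?_
    refine measure_mono_null ?_ (volume_preimage_inter_deriv_ne_zero hN fun t => E (y + t • e))
    intro t ht
    obtain ⟨h1, h2⟩ := Classical.not_imp.1 ht
    have hyt : y + (L.toLinearMap t) = y + t • e := by simp [L]
    rw [hyt] at h1 h2
    refine ⟨h1, _, h2, ?_⟩
    -- `fderiv` is zero by default where `E` is not differentiable, so `h2` forces
    -- differentiability.
    have hd : DifferentiableAt ℝ E (y + t • e) := by
      by_contra hnd
      exact h2 (by simp [fderiv_zero_of_not_differentiableAt hnd])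
    have hl : HasDerivAt (fun t : ℝ => y + t • e) e t := by
      simpa using ((hasDerivAt_id t).smul_const e).const_add y
    exact hd.hasFDerivAt.comp_hasDerivAt t hl
  have hall : ∀ᵐ θ, ∀ i : Fin d, E θ ∈ N → fderiv ℝ E θ (EuclideanSpace.single i 1) = 0 :=
    ae_all_iff.2 fun i => hline _
  have : ∀ᵐ θ, θ ∉ E ⁻¹' N := by
    filter_upwards [hall, hgrad] with θ h1 h2 h3
    obtain ⟨g, hg, hg'⟩ := h2
    refine hg (ext_inner_left ℝ fun x => ?_)
    have h4 : fderiv ℝ E θ = 0 := by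
      refine ContinuousLinearMap.coe_injective
        ((EuclideanSpace.basisFun (Fin d) ℝ).toBasis.ext fun i => ?_)
      simpa using h1 i h3
    have h5 := hg'.hasFDerivAt.fderiv
    rw [h4] at h5
    rw [real_inner_comm, ← InnerProductSpace.toDual_apply_apply (𝕜 := ℝ), ← h5]
    simp
  exact measure_eq_zero_iff_ae_notMem.2 this

/-- A Lipschitz function with almost everywhere vanishing gradient on a ball is constant near the
centre. -/
theorem eq_of_ae_gradient_eq_zero {d : ℕ} {E : EuclideanSpace ℝ (Fin d) → ℝ} {C : NNReal}
    (hE : LipschitzWith C E) {S : Set (EuclideanSpace ℝ (Fin d))} {x₀ : EuclideanSpace ℝ (Fin d)}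
    {r : ℝ} (hr : Metric.ball x₀ r ⊆ S) (hgrad : ∀ᵐ θ, θ ∈ S → HasGradientAt E 0 θ)
    {x : EuclideanSpace ℝ (Fin d)} (hx : x ∈ Metric.ball x₀ (r / 2)) : E x = E x₀ := by
  set e := x - x₀
  have he : ‖e‖ < r / 2 := by rwa [mem_ball_iff_norm] at hx
  have hr0 : 0 < r / 2 := (norm_nonneg _).trans_lt he
  let L : ℝ →L[ℝ] EuclideanSpace ℝ (Fin d) := ContinuousLinearMap.smulRight (1 : ℝ →L[ℝ] ℝ) e
  obtain ⟨G, hGs, hGm, hG⟩ :=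
    exists_measurable_superset_of_null (s := {θ | ¬ (θ ∈ S → HasGradientAt E 0 θ)}) hgrad
  have hae := (ae_ae_add_linearMap_mem_iff L.toLinearMap (volume : Measure ℝ) volume hGm.compl).2
    (measure_eq_zero_iff_ae_notMem.1 hG)
  -- The segment through the centre itself may lie in the exceptional set, but by Fubini almost
  -- every parallel segment meets it in a null set of parameters. Since `y` is within `r / 2` of the
  -- centre and `‖e‖ < r / 2`, the segment stays in the large ball.
  have hshift : ∀ᵐ y, y ∈ Metric.ball x₀ (r / 2) → E (y + e) = E y := by
    filter_upwards [hae] with y hy hyb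
    have hlip : LipschitzWith (C * ‖e‖₊) fun t : ℝ => E (y + t • e) := by
      refine hE.comp (LipschitzWith.of_dist_le_mul fun s t => ?_)
      rw [dist_add_left, dist_eq_norm, ← sub_smul, norm_smul, mul_comm]
      rfl
    have hFTC := (hlip.lipschitzOnWith (s := uIcc 0 1)).absolutelyContinuousOnInterval
      |>.integral_deriv_eq_sub
    have hzero : ∫ t in (0 : ℝ)..1, deriv (fun t : ℝ => E (y + t • e)) t = 0 := by
      refine intervalIntegral.integral_zero_ae ?_
      filter_upwards [hy] with t ht ht01
      rw [uIoc_of_le zero_le_one] at ht01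
      have hmem : y + t • e ∈ S := by
        refine hr ?_
        rw [mem_ball_iff_norm] at hyb ⊢
        calc ‖y + t • e - x₀‖ = ‖(y - x₀) + t • e‖ := by congr 1; abel
          _ ≤ ‖y - x₀‖ + ‖t • e‖ := norm_add_le _ _
          _ ≤ ‖y - x₀‖ + 1 * ‖e‖ := by
            rw [norm_smul, Real.norm_of_nonneg ht01.1.le]
            gcongr
            exact ht01.2
          _ < r := by linarith
      have hg : HasGradientAt E 0 (y + t • e) := by
        by_contra hng
        refine ht ?_
        have : y + L.toLinearMap t = y + t • e := by simp [L]
        rw [this]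
        exact hGs fun h => hng (h hmem)
      have hl : HasDerivAt (fun t : ℝ => y + t • e) e t := by
        simpa using ((hasDerivAt_id t).smul_const e).const_add y
      have := hg.hasFDerivAt.comp_hasDerivAt t hl
      simpa [Function.comp_def] using this.deriv
    rw [hzero] at hFTC
    simp only [one_smul, zero_smul, add_zero] at hFTC
    linarith
  -- Continuity upgrades the identity to every `y` in the ball, in particular to the centre.
  have hEq := Measure.eqOn_open_of_ae_eq (μ := volume)
    (f := fun y => E (y + e)) (g := E) (U := Metric.ball x₀ (r / 2))
    ((ae_restrict_iff' measurableSet_ball).2 hshift) Metric.isOpen_ball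
    (hE.continuous.comp (continuous_id.add continuous_const)).continuousOn
    hE.continuous.continuousOn
  have := hEq (Metric.mem_ball_self hr0)
  simpa [e] using this

end RealAnalysis

namespace WeightedGraph

/-! ### Matrix entries and self-adjointness of the Schrödinger operator -/

section SchrodingerOperator

variable {V : Type*} {d : ℕ} [AddAction (Fin d → ℤ) V] {Γ : WeightedGraph V}

theorem schrodingerOp_apply (hΓ : Γ.IsCrystal d) (ψ : EllTwo V) (x : V) :
    schrodingerOp hΓ ψ x = ∑' y, (Γ.w x y : ℂ) * ψ y + (Γ.Q x : ℂ) * ψ x := rfl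

open Classical in
/-- The Schrödinger operator applied to the delta function at `x`. -/
theorem schrodingerOp_single_apply (hΓ : Γ.IsCrystal d) (x y : V) :
    schrodingerOp hΓ (lp.single 2 x 1) y = (Γ.w y x : ℂ) + if y = x then (Γ.Q x : ℂ) else 0 := by
  rw [schrodingerOp_apply, tsum_eq_single x]
  · by_cases h : y = x
    · subst h; simp
    · simp [h]
  · intro z hz
    simp [hz]

theorem schrodingerOp_isSelfAdjoint (hΓ : Γ.IsCrystal d) : IsSelfAdjoint (schrodingerOp hΓ) := by
  classical
  rw [ContinuousLinearMap.isSelfAdjoint_iff']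
  ext ψ x
  have h1 : (ContinuousLinearMap.adjoint (schrodingerOp hΓ) ψ) x
      = ⟪lp.single 2 x (1 : ℂ), ContinuousLinearMap.adjoint (schrodingerOp hΓ) ψ⟫_ℂ := by
    rw [lp.inner_single_left]
    simp
  rw [h1, ContinuousLinearMap.adjoint_inner_right, lp.inner_eq_tsum, schrodingerOp_apply]
  have hQ : HasSum (fun y => if y = x then (Γ.Q x : ℂ) * ψ y else 0) ((Γ.Q x : ℂ) * ψ x) := by
    convert hasSum_single (f := fun y => if y = x then (Γ.Q x : ℂ) * ψ y else 0) x ?_ using 1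
    · simp
    · intro y hy
      simp [hy]
  rw [← ((Γ.summable_w_mul ψ x).hasSum.add hQ).tsum_eq]
  refine tsum_congr fun y => ?_
  rw [schrodingerOp_single_apply, Γ.w_symm y x, RCLike.inner_apply, map_add, Complex.conj_ofReal]
  by_cases h : y = x
  · subst h; simp; ring
  · simp [h, mul_comm]

end SchrodingerOperator

/-! ### Characters and Lebesgue measure on a unit cell of the torus -/

section FloquetCharacter

variable {d : ℕ}

/-- The character `θ ↦ exp(2πi θ·k)`. -/
def floquetChar (θ : EuclideanSpace ℝ (Fin d)) (k : Fin d → ℤ) : ℂ :=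
  Complex.exp (2 * Real.pi * Complex.I * ((∑ l, θ l * k l : ℝ) : ℂ))

theorem floquetChar_add (θ : EuclideanSpace ℝ (Fin d)) (k l : Fin d → ℤ) :
    floquetChar θ (k + l) = floquetChar θ k * floquetChar θ l := by
  simp only [floquetChar, ← Complex.exp_add, ← mul_add, ← Complex.ofReal_add,
    ← Finset.sum_add_distrib, Pi.add_apply, Int.cast_add]

theorem norm_floquetChar (θ : EuclideanSpace ℝ (Fin d)) (k : Fin d → ℤ) :
    ‖floquetChar θ k‖ = 1 := by
  have : floquetChar θ k = Complex.exp (((2 * Real.pi * ∑ l, θ l * k l : ℝ) : ℂ) * Complex.I) := by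
    rw [floquetChar]
    congr 1
    push_cast
    ring
  rw [this, Complex.norm_exp_ofReal_mul_I]

theorem continuous_floquetChar (k : Fin d → ℤ) :
    Continuous fun θ : EuclideanSpace ℝ (Fin d) => floquetChar θ k := by
  unfold floquetChar
  fun_prop

/-- Lebesgue measure on the translate by `a` of the unit cube. -/
def cellMeasure (a : Fin d → ℝ) : Measure (EuclideanSpace ℝ (Fin d)) :=
  (Measure.pi fun i => volume.restrict (Ioc (a i) (a i + 1))).map
    (MeasurableEquiv.toLp 2 (Fin d → ℝ))

instance (a : Fin d → ℝ) : IsProbabilityMeasure (cellMeasure a) := by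
  have : ∀ i, IsProbabilityMeasure (volume.restrict (Ioc (a i) (a i + 1))) := fun i =>
    ⟨by simp⟩
  exact Measure.isProbabilityMeasure_map (MeasurableEquiv.measurable _).aemeasurable

theorem cellMeasure_apply (a : Fin d → ℝ) (s : Set (EuclideanSpace ℝ (Fin d))) :
    cellMeasure a s
      = (volume.restrict (univ.pi fun i => Ioc (a i) (a i + 1))) (WithLp.toLp 2 ⁻¹' s) := by
  rw [cellMeasure, MeasurableEquiv.map_apply, volume_pi, Measure.restrict_pi_pi]
  rfl

theorem cellMeasure_absolutelyContinuous (a : Fin d → ℝ) : cellMeasure a ≪ volume := by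
  intro s hs
  rw [cellMeasure_apply]
  refine Measure.restrict_le_self.absolutelyContinuous ?_
  exact (MeasurePreserving.measure_preimage_equiv (f := MeasurableEquiv.toLp 2 (Fin d → ℝ))
    (PiLp.volume_preserving_toLp (Fin d)) s).trans hs

/-- Makes continuous Floquet eigenvalues almost surely bounded, as the moment argument requires. -/
theorem exists_isCompact_ae_mem_cellMeasure (a : Fin d → ℝ) :
    ∃ K : Set (EuclideanSpace ℝ (Fin d)), IsCompact K ∧ ∀ᵐ θ ∂cellMeasure a, θ ∈ K := by
  refine ⟨WithLp.toLp 2 '' (univ.pi fun i => Icc (a i) (a i + 1)),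
    (isCompact_univ_pi fun i => isCompact_Icc).image (PiLp.continuous_toLp 2 _), ?_⟩
  rw [ae_iff, cellMeasure_apply,
    Measure.restrict_apply' (MeasurableSet.univ_pi fun i => measurableSet_Ioc)]
  refine measure_mono_null ?_ measure_empty
  rintro x ⟨hx, hx'⟩
  exact hx ⟨x, fun i _ => Ioc_subset_Icc_self (hx' i trivial), rfl⟩

/-- The cell has its corner at `a`, so the ball contains a small open box of the cell. The free
choice of corner lets the cell be moved to the ball on which an eigenvalue is constant, in place of
an appeal to periodicity in `θ`. -/
theorem cellMeasure_ball_pos (a : EuclideanSpace ℝ (Fin d)) {r : ℝ} (hr : 0 < r) :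
    0 < cellMeasure (fun i => a i) (Metric.ball a r) := by
  rw [cellMeasure_apply, Measure.restrict_apply]
  · set U : Set (Fin d → ℝ) := WithLp.toLp 2 ⁻¹' Metric.ball a r with hU
    have hUo : IsOpen U := Metric.isOpen_ball.preimage (PiLp.continuous_toLp 2 _)
    have haU : (fun i => a i) ∈ U := Metric.mem_ball_self hr
    obtain ⟨ε, hε, hb⟩ := Metric.isOpen_iff.1 hUo _ haU
    have hsub : (univ.pi fun i => Ioo (a i) (a i + min ε 1)) ⊆
        U ∩ univ.pi fun i => Ioc (a i) (a i + 1) := by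
      intro x hx
      refine ⟨hb ?_, fun i hi => ⟨(hx i hi).1, ?_⟩⟩
      · refine (dist_pi_lt_iff hε).2 fun i => ?_
        have := hx i trivial
        rw [Real.dist_eq, abs_of_pos (sub_pos.2 this.1)]
        linarith [this.2, min_le_left ε 1]
      · linarith [(hx i hi).2, min_le_right ε 1]
    refine lt_of_lt_of_le ?_ (measure_mono hsub)
    rw [Real.volume_pi_Ioo]
    refine CanonicallyOrderedAdd.prod_pos.2 fun i _ => ?_
    simp [hε]
  · exact (Metric.isOpen_ball.preimage (PiLp.continuous_toLp 2 _)).measurableSet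

theorem integral_exp_Ioc (a : ℝ) (k : ℤ) :
    ∫ x in Ioc a (a + 1), Complex.exp (2 * Real.pi * Complex.I * (x * k))
      = if k = 0 then 1 else 0 := by
  rw [← intervalIntegral.integral_of_le (by linarith)]
  split_ifs with h
  · simp [h]
  · have hc : (2 * Real.pi * Complex.I * k : ℂ) ≠ 0 := by
      simp [Real.pi_ne_zero, h]
    have h1 : ∀ x : ℝ, (2 * Real.pi * Complex.I * (x * k) : ℂ) = (2 * Real.pi * Complex.I * k) * x :=
      fun x => by ring
    simp only [h1]
    rw [integral_exp_mul_complex hc, div_eq_zero_iff, sub_eq_zero]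
    left
    have h2 : (2 * Real.pi * Complex.I * k * ((a + 1 : ℝ) : ℂ) : ℂ)
        = 2 * Real.pi * Complex.I * k * a + k * (2 * Real.pi * Complex.I) := by
      push_cast; ring
    rw [h2, Complex.exp_add, Complex.exp_int_mul_two_pi_mul_I, mul_one]

theorem integral_floquetChar (a : Fin d → ℝ) (k : Fin d → ℤ) :
    ∫ θ, floquetChar θ k ∂cellMeasure a = if k = 0 then 1 else 0 := by
  rw [cellMeasure, integral_map_equiv]
  have h1 : ∀ x : Fin d → ℝ, floquetChar (MeasurableEquiv.toLp 2 (Fin d → ℝ) x) k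
      = ∏ l, Complex.exp (2 * Real.pi * Complex.I * (x l * k l)) := by
    intro x
    rw [← Complex.exp_sum, ← Finset.mul_sum, floquetChar]
    push_cast
    rfl
  simp only [h1]
  rw [integral_fintype_prod_eq_prod (𝕜 := ℂ)
    (fun l (x : ℝ) => Complex.exp (2 * Real.pi * Complex.I * (x * k l)))]
  simp only [integral_exp_Ioc, funext_iff, Pi.zero_apply]
  rw [Finset.prod_ite_zero]
  simp

end FloquetCharacter

end WeightedGraph

namespace WeightedGraph

/-! ### The Bloch transform and traces of powers of the Floquet matrix -/

section Bloch

variable {V : Type*} {d ν : ℕ} [AddAction (Fin d → ℤ) V] {Γ : WeightedGraph V}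

/-- The Bloch transform of a function on the vertices. -/
def bloch (v : Fin ν → V) (ψ : V → ℂ) (θ : EuclideanSpace ℝ (Fin d)) (i : Fin ν) : ℂ :=
  ∑' k : Fin d → ℤ, ψ (k +ᵥ v i) * floquetChar θ (-k)

theorem vadd_injective (hΓ : Γ.IsCrystal d) (x : V) :
    Function.Injective fun k : Fin d → ℤ => k +ᵥ x := by
  intro k l h
  have h' : k +ᵥ x = l +ᵥ x := h
  have := hΓ.free (-l + k) x (by rw [add_vadd, h', neg_vadd_vadd])
  exact (neg_add_eq_zero.1 this).symm

theorem summable_bloch (hΓ : Γ.IsCrystal d) {ψ : V → ℂ} (hψ : Summable ψ)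
    (θ : EuclideanSpace ℝ (Fin d)) (x : V) :
    Summable fun k : Fin d → ℤ => ψ (k +ᵥ x) * floquetChar θ (-k) := by
  refine Summable.of_norm ?_
  simp only [norm_mul, norm_floquetChar, mul_one]
  exact hψ.norm.comp_injective (vadd_injective hΓ x)

/-- Summing over the second vertex first costs at most the degree bound times `‖ψ x‖`. This absolute
summability licenses the interchange of sums in `bloch_schrodingerOp`. -/
theorem summable_w_mul_prod (hΓ : Γ.IsCrystal d) {ψ : V → ℂ} (hψ : Summable ψ) :
    Summable fun p : V × V => (Γ.w p.2 p.1 : ℂ) * ψ p.1 := by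
  obtain ⟨R, h0, hR⟩ := hΓ.exists_degree_bound
  refine Summable.of_norm ?_
  rw [summable_prod_of_nonneg fun p => norm_nonneg _]
  have h1 : ∀ x y, ‖(Γ.w y x : ℂ) * ψ x‖ = Γ.w x y * ‖ψ x‖ := fun x y => by
    rw [norm_mul, Complex.norm_real, Real.norm_of_nonneg (Γ.w_nonneg _ _), Γ.w_symm]
  simp only [h1]
  refine ⟨fun x => (Γ.w_summable x).mul_right _, ?_⟩
  refine Summable.of_nonneg_of_le
    (fun x => tsum_nonneg fun y => mul_nonneg (Γ.w_nonneg _ _) (norm_nonneg _))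
    (fun x => ?_) (hψ.norm.mul_left R)
  rw [tsum_mul_right]
  exact mul_le_mul_of_nonneg_right (hR x) (norm_nonneg _)

/-- Keeps the iterates of a delta absolutely summable, so their Bloch series converge pointwise and
no Plancherel theory is needed. -/
theorem summable_schrodingerOp (hΓ : Γ.IsCrystal d) {ψ : EllTwo V} (hψ : Summable ψ) :
    Summable (schrodingerOp hΓ ψ) := by
  obtain ⟨R, h0, hR⟩ := hΓ.exists_bound Γ.Q hΓ.Q_inv
  have h1 : Summable fun x => ∑' y, (Γ.w x y : ℂ) * ψ y :=
    (summable_w_mul_prod hΓ hψ).prod_symm.prod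
  have h2 : Summable fun x => (Γ.Q x : ℂ) * ψ x := by
    refine Summable.of_norm_bounded (hψ.norm.mul_left R) fun x => ?_
    rw [norm_mul, Complex.norm_real]
    exact mul_le_mul_of_nonneg_right (hR x) (norm_nonneg _)
  exact (h1.add h2).congr fun x => (schrodingerOp_apply hΓ ψ x).symm

/-- The Bloch transform of an integrable function intertwines the Schrödinger operator with the
Floquet matrix. -/
theorem bloch_schrodingerOp (hΓ : Γ.IsCrystal d) {v : Fin ν → V}
    (hv : IsFundamentalCell (d := d) v) {ψ : EllTwo V} (hψ : Summable ψ)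
    (θ : EuclideanSpace ℝ (Fin d)) :
    bloch v (schrodingerOp hΓ ψ) θ = (Γ.floquetMatrix v θ).mulVec (bloch v ψ θ) := by
  ext i
  have hA : Summable fun p : V × (Fin d → ℤ) =>
      (Γ.w (p.2 +ᵥ v i) p.1 : ℂ) * ψ p.1 * floquetChar θ (-p.2) := by
    refine Summable.of_norm ?_
    simp only [norm_mul, norm_floquetChar, mul_one]
    simp only [← norm_mul]
    have hinj : Function.Injective fun p : V × (Fin d → ℤ) => (p.1, p.2 +ᵥ v i) :=
      Function.injective_id.prodMap (vadd_injective hΓ (v i))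
    have h := (summable_w_mul_prod hΓ hψ).norm
    exact (h.comp_injective hinj).congr fun p => by rfl
  let b : Fin ν × (Fin d → ℤ) ≃ V := Equiv.ofBijective _ hv
  -- The substitution `k = m - l` and invariance of the weights exhibit a convolution over the
  -- lattice, which the characters turn into a product.
  have hinner : ∀ (j : Fin ν) (m : Fin d → ℤ),
      ∑' k : Fin d → ℤ, (Γ.w (k +ᵥ v i) (m +ᵥ v j) : ℂ) * ψ (m +ᵥ v j) * floquetChar θ (-k)
        = (∑' l : Fin d → ℤ, (Γ.w (v i) (l +ᵥ v j) : ℂ) * floquetChar θ l)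
          * (ψ (m +ᵥ v j) * floquetChar θ (-m)) := by
    intro j m
    rw [← tsum_mul_right, ← (Equiv.subLeft m).tsum_eq]
    refine tsum_congr fun l => ?_
    have h1 : Γ.w ((m - l) +ᵥ v i) (m +ᵥ v j) = Γ.w (v i) (l +ᵥ v j) := by
      rw [← hΓ.w_inv (m - l) (v i), vadd_vadd, sub_add_cancel]
    rw [Equiv.subLeft_apply, h1, show -(m - l) = l + -m by abel, floquetChar_add]
    ring
  have hadj : ∑' k : Fin d → ℤ, (∑' y, (Γ.w (k +ᵥ v i) y : ℂ) * ψ y) * floquetChar θ (-k)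
      = ∑ j, (∑' l : Fin d → ℤ, (Γ.w (v i) (l +ᵥ v j) : ℂ) * floquetChar θ l) * bloch v ψ θ j := by
    calc _ = ∑' k : Fin d → ℤ, ∑' y, (Γ.w (k +ᵥ v i) y : ℂ) * ψ y * floquetChar θ (-k) :=
          tsum_congr fun k => tsum_mul_right.symm
      _ = ∑' y, ∑' k : Fin d → ℤ, (Γ.w (k +ᵥ v i) y : ℂ) * ψ y * floquetChar θ (-k) :=
          hA.tsum_comm
      _ = ∑' p : Fin ν × (Fin d → ℤ), ∑' k : Fin d → ℤ,
            (Γ.w (k +ᵥ v i) (b p) : ℂ) * ψ (b p) * floquetChar θ (-k) := (b.tsum_eq _).symm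
      _ = ∑' j : Fin ν, ∑' m : Fin d → ℤ, ∑' k : Fin d → ℤ,
            (Γ.w (k +ᵥ v i) (m +ᵥ v j) : ℂ) * ψ (m +ᵥ v j) * floquetChar θ (-k) :=
          (b.summable_iff.2 hA.prod).tsum_prod
      _ = _ := by
        rw [tsum_fintype]
        refine Finset.sum_congr rfl fun j _ => ?_
        simp only [hinner, tsum_mul_left]
        rfl
  have hpot : ∀ k : Fin d → ℤ, (Γ.Q (k +ᵥ v i) : ℂ) * ψ (k +ᵥ v i) * floquetChar θ (-k)
      = Γ.Q (v i) * (ψ (k +ᵥ v i) * floquetChar θ (-k)) := fun k => by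
    rw [hΓ.Q_inv, mul_assoc]
  have hs1 : Summable fun k : Fin d → ℤ =>
      (∑' y, (Γ.w (k +ᵥ v i) y : ℂ) * ψ y) * floquetChar θ (-k) :=
    hA.prod_symm.prod.congr fun k => by
      simp only [Prod.swap_prod_mk, tsum_mul_right]
  have hs2 := (summable_bloch hΓ hψ θ (v i)).mul_left (Γ.Q (v i) : ℂ)
  rw [bloch]
  simp only [schrodingerOp_apply, add_mul, hpot]
  rw [hs1.tsum_add hs2, hadj, tsum_mul_left]
  simp only [Matrix.mulVec, dotProduct, floquetMatrix, Matrix.of_apply, add_mul, ite_mul, zero_mul,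
    Finset.sum_add_distrib, Finset.sum_ite_eq, Finset.mem_univ, if_true]
  rfl

/-- The Fourier inversion formula for the Bloch transform of an integrable function. -/
theorem integral_bloch (hΓ : Γ.IsCrystal d) (v : Fin ν → V) {ψ : V → ℂ} (hψ : Summable ψ)
    (a : Fin d → ℝ) (i : Fin ν) :
    Integrable (fun θ => bloch (d := d) v ψ θ i) (cellMeasure a) ∧
      ∫ θ, bloch (d := d) v ψ θ i ∂cellMeasure a = ψ (v i) := by
  have hnorm : ∀ (k : Fin d → ℤ) (θ : EuclideanSpace ℝ (Fin d)),
      ‖ψ (k +ᵥ v i) * floquetChar θ (-k)‖ = ‖ψ (k +ᵥ v i)‖ := fun k θ => by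
    rw [norm_mul, norm_floquetChar, mul_one]
  have hs : Summable fun k : Fin d → ℤ => ‖ψ (k +ᵥ v i)‖ :=
    hψ.norm.comp_injective (vadd_injective hΓ (v i))
  have hcont : ∀ k : Fin d → ℤ,
      Continuous fun θ : EuclideanSpace ℝ (Fin d) => ψ (k +ᵥ v i) * floquetChar θ (-k) :=
    fun k => continuous_const.mul (continuous_floquetChar _)
  have hint : ∀ k : Fin d → ℤ,
      Integrable (fun θ => ψ (k +ᵥ v i) * floquetChar θ (-k)) (cellMeasure a) := fun k =>
    Integrable.of_bound (hcont k).aestronglyMeasurable ‖ψ (k +ᵥ v i)‖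
      (Filter.Eventually.of_forall fun θ => (hnorm k θ).le)
  constructor
  · refine Integrable.of_bound (C := ∑' k : Fin d → ℤ, ‖ψ (k +ᵥ v i)‖)
      (continuous_tsum hcont hs fun k θ => (hnorm k θ).le).aestronglyMeasurable
      (Filter.Eventually.of_forall fun θ => ?_)
    exact tsum_of_norm_bounded hs.hasSum fun k => (hnorm k θ).le
  · have h := (hasSum_integral_of_summable_integral_norm hint (by
      simp only [hnorm, integral_const, probReal_univ, one_smul]
      exact hs)).tsum_eq
    simp only [bloch]
    rw [← h, tsum_eq_single 0]
    · rw [integral_const_mul, integral_floquetChar]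
      simp
    · intro k hk
      rw [integral_const_mul, integral_floquetChar]
      simp [hk]

open Classical in
theorem bloch_single (hv : IsFundamentalCell (d := d) (V := V) (ν := ν) v)
    (θ : EuclideanSpace ℝ (Fin d)) (j : Fin ν) :
    bloch v (lp.single 2 (v j) (1 : ℂ) : EllTwo V) θ = Pi.single j 1 := by
  ext i
  have hne : ∀ k : Fin d → ℤ, k +ᵥ v i = v j ↔ i = j ∧ k = 0 := by
    intro k
    have := hv.1.eq_iff (a := (i, k)) (b := (j, 0))
    simpa using this
  rw [bloch, tsum_eq_single 0]
  · by_cases h : i = j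
    · subst h; simp [floquetChar]
    · have : v i ≠ v j := fun h' => h ((hne 0).1 (by simpa using h')).1
      simp [h, this]
  · intro k hk
    have : k +ᵥ v i ≠ v j := fun h' => hk ((hne k).1 h').2
    simp [this]

open Classical in
/-- Matrix elements of powers of the Schrödinger operator in terms of the Floquet matrix. -/
theorem schrodingerOp_pow_single (hΓ : Γ.IsCrystal d) {v : Fin ν → V}
    (hv : IsFundamentalCell (d := d) v) (j : Fin ν) (n : ℕ) :
    Summable ((schrodingerOp hΓ ^ n) (lp.single 2 (v j) (1 : ℂ))) ∧
      ∀ θ : EuclideanSpace ℝ (Fin d), bloch v ((schrodingerOp hΓ ^ n) (lp.single 2 (v j) (1 : ℂ))) θ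
        = (Γ.floquetMatrix v θ ^ n).mulVec (Pi.single j 1) := by
  induction n with
  | zero =>
    refine ⟨summable_of_ne_finset_zero (s := {v j}) fun x hx => ?_, fun θ => ?_⟩
    · have : x ≠ v j := by simpa using hx
      simp [this]
    · rw [pow_zero, pow_zero, Matrix.one_mulVec, one_apply_eq_self]
      exact bloch_single hv θ j
  | succ n ih =>
    rw [pow_succ']
    refine ⟨summable_schrodingerOp hΓ ih.1, fun θ => ?_⟩
    rw [mul_apply_eq_comp, bloch_schrodingerOp hΓ hv ih.1, ih.2, pow_succ',
      Matrix.mulVec_mulVec]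

theorem trace_pow_floquetMatrix (hΓ : Γ.IsCrystal d) (v : Fin ν → V)
    (θ : EuclideanSpace ℝ (Fin d)) (n : ℕ) :
    (Γ.floquetMatrix v θ ^ n).trace = ((∑ j, floquetEigenvalue hΓ v j θ ^ n : ℝ) : ℂ) := by
  set hH := floquetMatrix_isHermitian hΓ v θ
  have h1 : (Γ.floquetMatrix v θ ^ n).trace = ∑ i, (hH.eigenvalues i : ℂ) ^ n := by
    conv_lhs => rw [hH.spectral_theorem, ← map_pow, Unitary.conjStarAlgAut_apply,
      Matrix.trace_mul_comm, ← mul_assoc, Unitary.coe_star_mul_self, one_mul, Matrix.diagonal_pow,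
      Matrix.trace_diagonal]
    rfl
  rw [h1]
  push_cast
  -- `floquetEigenvalue` reads `eigenvalues₀` backwards, and `eigenvalues` reindexes it by another
  -- equivalence; the sum ignores the resulting permutation.
  let e : Fin ν ≃ Fin ν := Fin.revPerm.trans ((finCongr (Fintype.card_fin ν).symm).trans
    (Fintype.equivOfCardEq (Fintype.card_fin _)))
  refine (Fintype.sum_equiv e _ _ fun j => ?_).symm
  simp [e, floquetEigenvalue, Matrix.IsHermitian.eigenvalues]

end Bloch

end WeightedGraph

/-! ### Spectral measures of bounded self-adjoint operators -/

section SpectralMeasures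

variable {E : Type*} [NormedAddCommGroup E] [InnerProductSpace ℂ E] [CompleteSpace E]
  {T : E →L[ℂ] E}

theorem inner_cfc_eq_re (f : ℝ → ℝ) (ψ : E) :
    ⟪ψ, cfc f T ψ⟫_ℂ = ((⟪ψ, cfc f T ψ⟫_ℂ).re : ℂ) := by
  have h : IsSelfAdjoint (cfc f T) := cfc_predicate f T
  have := h.isSymmetric ψ ψ
  exact (Complex.conj_eq_iff_re.1 ((inner_conj_symm _ _).trans this)).symm

theorem re_inner_cfc_nonneg {f : ℝ → ℝ} (hf : ∀ x ∈ spectrum ℝ T, 0 ≤ f x) (ψ : E) :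
    0 ≤ (⟪ψ, cfc f T ψ⟫_ℂ).re :=
  ((ContinuousLinearMap.nonneg_iff_isPositive _).1 (cfc_nonneg hf)).re_inner_nonneg_right ψ

open scoped CompactlySupported in
/-- Every vector has a spectral measure, by the Riesz–Markov–Kakutani theorem. -/
theorem IsSelfAdjoint.exists_isSpectralMeasure (hT : IsSelfAdjoint T) (ψ : E) :
    ∃ μ : Measure ℝ, IsSpectralMeasure T ψ μ := by
  have : CompactSpace (spectrum ℝ T) :=
    isCompact_iff_compactSpace.1 (ContinuousFunctionalCalculus.isCompact_spectrum T)
  let Λ : C_c(spectrum ℝ T, ℝ) →ₚ[ℝ] ℝ :=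
  { toFun g := (⟪ψ, cfcHom hT (g : C(spectrum ℝ T, ℝ)) ψ⟫_ℂ).re
    map_add' g g' := by
      have : ((g + g' : C_c(spectrum ℝ T, ℝ)) : C(spectrum ℝ T, ℝ)) = g + g' := rfl
      rw [this, map_add, add_apply, inner_add_right, Complex.add_re]
    map_smul' c g := by
      have : ((c • g : C_c(spectrum ℝ T, ℝ)) : C(spectrum ℝ T, ℝ)) = c • g := rfl
      rw [this, map_smul, smul_apply, inner_smul_right_eq_smul,
        Complex.smul_re]
      rfl
    monotone' g g' hgg' := by
      have h : cfcHom hT (g : C(spectrum ℝ T, ℝ)) ≤ cfcHom hT (g' : C(spectrum ℝ T, ℝ)) :=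
        cfcHom_mono hT hgg'
      have := ((ContinuousLinearMap.le_def _ _).1 h).re_inner_nonneg_right ψ
      rw [sub_apply, inner_sub_right, map_sub] at this
      exact sub_nonneg.1 this }
  refine ⟨(RealRMK.rieszMeasure Λ).map Subtype.val, inferInstance, fun f => ?_⟩
  rw [inner_cfc_eq_re, integral_map measurable_subtype_coe.aemeasurable
    f.continuous.aestronglyMeasurable]
  let g : C_c(spectrum ℝ T, ℝ) :=
  { toFun := fun x => f x
    continuous_toFun := f.continuous.comp continuous_subtype_val
    hasCompactSupport' := HasCompactSupport.of_compactSpace _ }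
  have h := RealRMK.integral_rieszMeasure Λ g
  rw [cfc_apply (f : ℝ → ℝ) T hT f.continuous.continuousOn]
  exact congrArg _ h.symm

variable {ψ φ : E} {μ ρ : Measure ℝ}

theorem IsSpectralMeasure.integral_eq (h : IsSpectralMeasure T ψ μ) (f : ℝ →ᵇ ℝ) :
    ∫ x, f x ∂μ = (⟪ψ, cfc (f : ℝ → ℝ) T ψ⟫_ℂ).re := by
  rw [h.2 f, Complex.ofReal_re]

theorem IsSpectralMeasure.measure_univ (hT : IsSelfAdjoint T) (h : IsSpectralMeasure T ψ μ) :
    μ univ = ENNReal.ofReal (‖ψ‖ ^ 2) := by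
  have := h.1
  have h1 := h.integral_eq 1
  have h2 : cfc ((1 : ℝ →ᵇ ℝ) : ℝ → ℝ) T = 1 := cfc_one ℝ T
  rw [h2, one_apply_eq_self] at h1
  have h3 : (⟪ψ, ψ⟫_ℂ).re = ‖ψ‖ ^ 2 := (norm_sq_eq_re_inner (𝕜 := ℂ) ψ).symm
  rw [h3] at h1
  rw [← h1, ← ofReal_measureReal]
  simp

/-- For `f ≥ 0` the form of `f(T)` is nonnegative at `ψ - φ`; the parallelogram identity then bounds
its value at `ψ + φ`. -/
theorem IsSpectralMeasure.add_le {κ : Measure ℝ} (h : IsSpectralMeasure T ψ μ)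
    (h' : IsSpectralMeasure T φ ρ) (hs : IsSpectralMeasure T (ψ + φ) κ) :
    κ ≤ 2 • (μ + ρ) := by
  have := h.1
  have := h'.1
  have := hs.1
  have : IsFiniteMeasure (2 • (μ + ρ)) := by rw [two_smul]; infer_instance
  refine measure_le_of_forall_integral_le fun f hf => ?_
  have hi : ∀ (m : Measure ℝ) [IsFiniteMeasure m], Integrable f m := fun m _ => f.integrable m
  rw [two_smul, integral_add_measure (hi _) (hi _), integral_add_measure (hi _) (hi _),
    hs.integral_eq, h.integral_eq, h'.integral_eq]
  have hn := re_inner_cfc_nonneg (T := T) (f := f) (fun x _ => hf x) (ψ - φ)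
  simp only [map_add, map_sub, inner_add_left, inner_add_right, inner_sub_left, inner_sub_right,
    Complex.add_re, Complex.sub_re] at hn ⊢
  linarith

theorem IsSpectralMeasure.smul_le {κ : Measure ℝ} (c : ℂ) (h : IsSpectralMeasure T ψ μ)
    (hs : IsSpectralMeasure T (c • ψ) κ) : κ ≤ (‖c‖₊ ^ 2) • μ := by
  have := h.1
  have := hs.1
  refine measure_le_of_forall_integral_le fun f hf => ?_
  rw [integral_smul_nnreal_measure, hs.integral_eq, h.integral_eq, map_smul, inner_smul_left,
    inner_smul_right, ← mul_assoc, ← Complex.normSq_eq_conj_mul_self, Complex.re_ofReal_mul,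
    Complex.normSq_eq_norm_sq]
  rfl

/-- `T` has an absolutely continuous spectral measure at `ψ`. -/
def IsACVector (T : E →L[ℂ] E) (ψ : E) : Prop :=
  ∃ μ : Measure ℝ, IsSpectralMeasure T ψ μ ∧ μ ≪ volume

theorem IsACVector.add (hT : IsSelfAdjoint T) (h : IsACVector T ψ) (h' : IsACVector T φ) :
    IsACVector T (ψ + φ) := by
  obtain ⟨μ, hμ, hμac⟩ := h
  obtain ⟨ρ, hρ, hρac⟩ := h'
  obtain ⟨κ, hκ⟩ := hT.exists_isSpectralMeasure (ψ + φ)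
  refine ⟨κ, hκ, (hμ.add_le hρ hκ).absolutelyContinuous.trans (Measure.AbsolutelyContinuous.mk
    fun s _ hs => ?_)⟩
  simp [hμac hs, hρac hs]

theorem IsACVector.smul (hT : IsSelfAdjoint T) (c : ℂ) (h : IsACVector T ψ) :
    IsACVector T (c • ψ) := by
  obtain ⟨μ, hμ, hμac⟩ := h
  obtain ⟨κ, hκ⟩ := hT.exists_isSpectralMeasure (c • ψ)
  refine ⟨κ, hκ, (hμ.smul_le c hκ).absolutelyContinuous.trans (Measure.AbsolutelyContinuous.mk
    fun s _ hs => ?_)⟩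
  simp [hμac hs]

theorem IsACVector.zero (hT : IsSelfAdjoint T) : IsACVector T 0 := by
  obtain ⟨κ, hκ⟩ := hT.exists_isSpectralMeasure 0
  have := hκ.measure_univ hT
  rw [norm_zero, zero_pow two_ne_zero, ENNReal.ofReal_zero, Measure.measure_univ_eq_zero] at this
  exact ⟨κ, hκ, this ▸ Measure.AbsolutelyContinuous.zero _⟩

theorem IsACVector.sum (hT : IsSelfAdjoint T) {ι : Type*} (s : Finset ι) {g : ι → E}
    (h : ∀ i ∈ s, IsACVector T (g i)) : IsACVector T (∑ i ∈ s, g i) :=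
  Finset.sum_induction _ _ (fun _ _ => IsACVector.add hT) (IsACVector.zero hT) h

/-- The vectors with absolutely continuous spectral measure form a closed set. -/
theorem IsACVector.of_forall_dist_lt (hT : IsSelfAdjoint T)
    (h : ∀ ε > 0, ∃ φ, IsACVector T φ ∧ ‖ψ - φ‖ < ε) : IsACVector T ψ := by
  obtain ⟨κ, hκ⟩ := hT.exists_isSpectralMeasure ψ
  refine ⟨κ, hκ, fun s hs => ?_⟩
  refine le_antisymm (ENNReal.le_of_forall_pos_le_add fun ε hε _ => ?_) zero_le
  -- By `add_le` the mass of `s` is at most twice that given by `ψ - φ`, whose total mass `‖ψ - φ‖ ^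
  -- 2` is below `ε / 2`.
  obtain ⟨φ, ⟨μ, hμ, hμac⟩, hd⟩ := h (Real.sqrt (ε / 2)) (Real.sqrt_pos.2 (by positivity))
  obtain ⟨ρ, hρ⟩ := hT.exists_isSpectralMeasure (ψ - φ)
  rw [← add_sub_cancel φ ψ] at hκ
  have h1 := hμ.add_le hρ hκ s
  rw [Measure.smul_apply, Measure.add_apply, hμac hs, zero_add] at h1
  rw [zero_add]
  refine h1.trans ((nsmul_le_nsmul_right (measure_mono (subset_univ s)) 2).trans ?_)
  rw [hρ.measure_univ hT, ← ENNReal.ofReal_nsmul, ← ENNReal.ofReal_coe_nnreal]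
  refine ENNReal.ofReal_le_ofReal ?_
  have h2 : ‖ψ - φ‖ ^ 2 ≤ ε / 2 := by
    rw [← Real.sq_sqrt (show (0 : ℝ) ≤ ε / 2 by positivity)]
    exact pow_le_pow_left₀ (norm_nonneg _) hd.le 2
  rw [nsmul_eq_mul]
  push_cast
  linarith

open Polynomial in
/-- If the moments of `T` at finitely many vectors add up to the moments of a family of bounded
random variables, the spectral measures add up to the laws of these random variables. -/
theorem sum_spectralMeasure_eq_sum_map (hT : IsSelfAdjoint T) {ι κ Ω : Type*} [Fintype ι]
    [Fintype κ] [MeasurableSpace Ω] {P : Measure Ω} [IsProbabilityMeasure P] {e : ι → E}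
    {μ : ι → Measure ℝ} (hμ : ∀ i, IsSpectralMeasure T (e i) (μ i)) {X : κ → Ω → ℝ}
    (hX : ∀ j, Measurable (X j)) {C : ℝ} (hC : ∀ᵐ ω ∂P, ∀ j, |X j ω| ≤ C)
    (hpow : ∀ n : ℕ, ∑ i, ⟪e i, (T ^ n) (e i)⟫_ℂ = ((∫ ω, ∑ j, X j ω ^ n ∂P : ℝ) : ℂ)) :
    ∑ i, μ i = ∑ j, P.map (X j) := by
  have hfin : ∀ i, IsFiniteMeasure (μ i) := fun i => (hμ i).1
  have hint : ∀ {f : ℝ → ℝ}, Continuous f → Integrable (fun ω => ∑ j, f (X j ω)) P := by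
    intro f hf
    obtain ⟨D, hD⟩ := (isCompact_Icc (a := -C) (b := C)).exists_bound_of_continuousOn
      hf.continuousOn
    refine integrable_finsetSum _ fun j _ =>
      Integrable.of_bound (hf.measurable.comp (hX j)).aestronglyMeasurable D ?_
    filter_upwards [hC] with ω hω
    exact hD _ (abs_le.1 (hω j))
  have hpoly : ∀ p : ℝ[X], ∑ i, ⟪e i, aeval T p (e i)⟫_ℂ
      = ((∫ ω, ∑ j, p.eval (X j ω) ∂P : ℝ) : ℂ) := by
    intro p
    induction p using Polynomial.induction_on' with
    | add p q hp hq =>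
      simp only [map_add, eval_add, Finset.sum_add_distrib, add_apply, inner_add_right]
      rw [integral_add (hint p.continuous) (hint q.continuous), Complex.ofReal_add, ← hp, ← hq]
    | monomial n c =>
      simp only [aeval_monomial, eval_monomial, ← Finset.mul_sum, ← Algebra.smul_def, smul_apply]
      rw [integral_const_mul, Complex.ofReal_mul, ← hpow n, Finset.mul_sum]
      refine Finset.sum_congr rfl fun i _ => ?_
      rw [inner_smul_right_eq_smul, Complex.real_smul]
  -- One interval contains both the spectrum and almost all values of the `X j`, so a single
  -- polynomial approximation serves both sides.
  obtain ⟨R, hCR, hR⟩ : ∃ R : ℝ, C ≤ R ∧ spectrum ℝ T ⊆ Icc (-R) R := by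
    obtain ⟨R, hR⟩ := (ContinuousFunctionalCalculus.isCompact_spectrum (R := ℝ) T).isBounded
      |>.subset_closedBall 0
    refine ⟨max C R, le_max_left _ _, fun x hx => ?_⟩
    have := hR hx
    rw [Real.closedBall_eq_Icc, zero_sub, zero_add] at this
    exact ⟨(neg_le_neg (le_max_right _ _)).trans this.1, this.2.trans (le_max_right _ _)⟩
  have hcfc : ∀ f : ℝ → ℝ, Continuous f → ∑ i, ⟪e i, cfc f T (e i)⟫_ℂ
      = ((∫ ω, ∑ j, f (X j ω) ∂P : ℝ) : ℂ) := by
    intro f hf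
    -- The total of the two error coefficients; the added `1` keeps it positive when both sums are
    -- empty.
    set D : ℝ := ∑ i, ‖e i‖ * ‖e i‖ + Fintype.card κ + 1 with hD
    have hsum : 0 ≤ ∑ i, ‖e i‖ * ‖e i‖ := Finset.sum_nonneg fun i _ => by positivity
    have hD0 : 0 < D := by positivity
    refine eq_of_forall_dist_le fun ε hε => ?_
    obtain ⟨p, hp⟩ := exists_polynomial_near_of_continuousOn (-R) R f hf.continuousOn (ε / D)
      (by positivity)
    have hnorm : ‖cfc f T - aeval T p‖ ≤ ε / D := by
      rw [← cfc_polynomial p T, ← cfc_sub f p.eval T hf.continuousOn p.continuous.continuousOn]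
      refine norm_cfc_le (by positivity) fun x hx => ?_
      rw [← norm_neg, neg_sub]
      exact (hp x (hR hx)).le
    have h1 : ‖∑ i, ⟪e i, cfc f T (e i)⟫_ℂ - ∑ i, ⟪e i, aeval T p (e i)⟫_ℂ‖
        ≤ (∑ i, ‖e i‖ * ‖e i‖) * (ε / D) := by
      rw [← Finset.sum_sub_distrib, Finset.sum_mul]
      refine norm_sum_le_of_le _ fun i _ => ?_
      rw [← inner_sub_right, ← sub_apply]
      refine (norm_inner_le_norm _ _).trans ?_
      rw [mul_assoc]
      refine mul_le_mul_of_nonneg_left ((ContinuousLinearMap.le_opNorm _ _).trans ?_)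
        (norm_nonneg _)
      rw [mul_comm]
      exact mul_le_mul_of_nonneg_left hnorm (norm_nonneg _)
    have h2 : ‖(∫ ω, ∑ j, p.eval (X j ω) ∂P) - ∫ ω, ∑ j, f (X j ω) ∂P‖
        ≤ Fintype.card κ * (ε / D) := by
      rw [← integral_sub (hint p.continuous) (hint hf)]
      refine (norm_integral_le_of_norm_le_const (hC.mono fun ω hω => ?_)).trans
        (le_of_eq (by rw [probReal_univ, mul_one]))
      rw [← Finset.sum_sub_distrib]
      refine (norm_sum_le_of_le (n := fun _ => ε / D) _ fun j _ => ?_).trans (le_of_eq (by simp))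
      exact (hp _ (abs_le.1 ((hω j).trans hCR))).le
    rw [← Complex.norm_real, Complex.ofReal_sub, ← hpoly] at h2
    rw [dist_eq_norm]
    calc _ ≤ (∑ i, ‖e i‖ * ‖e i‖) * (ε / D) + Fintype.card κ * (ε / D) :=
          (norm_sub_le_norm_sub_add_norm_sub _ _ _).trans (add_le_add h1 h2)
      _ = (D - 1) * (ε / D) := by rw [hD]; ring
      _ ≤ D * (ε / D) := mul_le_mul_of_nonneg_right (by linarith) (by positivity)
      _ = ε := by field_simp
  have : ∀ j, IsProbabilityMeasure (P.map (X j)) := fun j =>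
    Measure.isProbabilityMeasure_map (hX j).aemeasurable
  refine ext_of_forall_integral_eq_of_IsFiniteMeasure fun f => ?_
  rw [integral_finsetSum_measure fun i _ => f.integrable (μ i),
    integral_finsetSum_measure fun j _ => f.integrable _]
  have h := hcfc f f.continuous
  simp only [fun i => (hμ i).2 f, ← Complex.ofReal_sum, Complex.ofReal_inj] at h
  rw [h, integral_finsetSum]
  · exact Finset.sum_congr rfl fun j _ =>
      (integral_map (hX j).aemeasurable f.continuous.aestronglyMeasurable).symm
  · intro j _
    exact (f.integrable (P.map (X j))).comp_measurable (hX j)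

open Filter Topology in
/-- An atom of a spectral measure is an eigenvalue. -/
theorem IsSpectralMeasure.exists_apply_eq_smul (hT : IsSelfAdjoint T) (h : IsSpectralMeasure T ψ μ)
    {lam : ℝ} (hlam : μ {lam} ≠ 0) : ∃ φ : E, φ ≠ 0 ∧ T φ = (lam : ℂ) • φ := by
  have hfin := h.1
  -- `f` takes values in `(0, 1]` and equals `1` only at `lam`, so the fixed vectors of the
  -- contraction `f(T)` should be the eigenvectors for `lam`.
  let f : ℝ → ℝ := fun x => (1 + (x - lam) ^ 2)⁻¹
  have hpos : ∀ x, 0 < 1 + (x - lam) ^ 2 := fun x => by positivity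
  have hf : Continuous f := (by fun_prop : Continuous fun x : ℝ => 1 + (x - lam) ^ 2).inv₀
    fun x => (hpos x).ne'
  have hf0 : ∀ x, 0 ≤ f x := fun x => (inv_pos.2 (hpos x)).le
  have hf1 : ∀ x, f x ≤ 1 := fun x => inv_le_one_of_one_le₀ (by nlinarith [sq_nonneg (x - lam)])
  have hflam : f lam = 1 := by simp [f]
  set A := cfc f T with hA
  have hA1 : ‖A‖ ≤ 1 := norm_cfc_le zero_le_one fun x _ => by
    rw [Real.norm_of_nonneg (hf0 x)]
    exact hf1 x
  have hpow : ∀ n : ℕ, μ.real {lam} ≤ (⟪ψ, (A ^ n) ψ⟫_ℂ).re := by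
    intro n
    let g : ℝ →ᵇ ℝ := BoundedContinuousFunction.ofNormedAddCommGroup (fun x => f x ^ n)
      (hf.pow n) 1 fun x => by
        rw [Real.norm_of_nonneg (pow_nonneg (hf0 x) n)]
        exact pow_le_one₀ (hf0 x) (hf1 x)
    have h1 := h.integral_eq g
    have h2 : cfc (g : ℝ → ℝ) T = A ^ n := cfc_pow f n T hf.continuousOn
    rw [← h2, ← h1, ← integral_indicator_one (measurableSet_singleton lam)]
    refine integral_mono ((integrable_const (1 : ℝ)).indicator (measurableSet_singleton lam))
      (g.integrable μ) fun x => ?_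
    refine indicator_le' (fun y hy => ?_) (fun y _ => pow_nonneg (hf0 y) n) x
    rw [mem_singleton_iff.1 hy]
    change 1 ≤ f lam ^ n
    rw [hflam, one_pow]
  -- The averages of `A ^ n ψ` tend to the projection `φ` of `ψ` onto the fixed space. Each pairing
  -- of `ψ` with `A ^ n ψ` is at least the mass of the atom, so `φ` cannot vanish.
  have herg := A.tendsto_birkhoffAverage_orthogonalProjection hA1 ψ
  set φ : E := ((A.eqLocus (1 : E →L[ℂ] E)).orthogonalProjectionOnto ψ : E) with hφ
  have hAφ : A φ = φ := ((A.eqLocus (1 : E →L[ℂ] E)).orthogonalProjectionOnto ψ).2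
  have hφ0 : φ ≠ 0 := by
    intro h0
    have hlim : Tendsto (fun N => (⟪ψ, birkhoffAverage ℂ A _root_.id N ψ⟫_ℂ).re) atTop
        (𝓝 (⟪ψ, φ⟫_ℂ).re) :=
      (Complex.continuous_re.tendsto _).comp (tendsto_const_nhds.inner herg)
    rw [h0, inner_zero_right, Complex.zero_re] at hlim
    have hge : ∀ᶠ N : ℕ in atTop,
        μ.real {lam} ≤ (⟪ψ, birkhoffAverage ℂ A _root_.id N ψ⟫_ℂ).re := by
      filter_upwards [eventually_gt_atTop 0] with N hN
      have hN' : (0 : ℝ) < N := Nat.cast_pos.2 hN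
      have hiter : ∀ n : ℕ, A^[n] ψ = (A ^ n) ψ := fun n => by
        induction n with
        | zero => rw [Function.iterate_zero, id, pow_zero, one_apply_eq_self]
        | succ n ih => rw [Function.iterate_succ_apply', ih, pow_succ', mul_apply_eq_comp]
      simp only [birkhoffAverage, birkhoffSum, id, inner_smul_right, inner_sum, hiter]
      have hc : ((N : ℂ)⁻¹) = ((N : ℝ)⁻¹ : ℝ) := by push_cast; rfl
      rw [hc, Complex.re_ofReal_mul, Complex.re_sum, ← div_eq_inv_mul, le_div_iff₀ hN', mul_comm]
      calc (N : ℝ) * μ.real {lam} = ∑ n ∈ Finset.range N, μ.real {lam} := by simp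
        _ ≤ _ := Finset.sum_le_sum fun n _ => hpow n
    have := ge_of_tendsto hlim hge
    exact hlam ((measureReal_eq_zero_iff).1 (le_antisymm this measureReal_nonneg))
  refine ⟨φ, hφ0, ?_⟩
  set B := cfc (fun x : ℝ => x - lam) T with hB
  have hcB : Continuous fun x : ℝ => x - lam := by fun_prop
  -- From `(x - lam) ^ 2 * f x = 1 - f x`: a vector fixed by `A` is killed by `B * B`, hence by the
  -- self-adjoint `B`.
  have hBA : B * B * A = 1 - A := by
    rw [hA, hB, ← cfc_mul _ _ T hcB.continuousOn hcB.continuousOn,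
      ← cfc_mul _ _ T (by fun_prop) hf.continuousOn, ← cfc_one ℝ T,
      ← cfc_sub 1 f T continuousOn_const hf.continuousOn]
    congr 1
    ext x
    have := (hpos x).ne'
    simp only [f, Pi.one_apply]
    field_simp
    ring
  have hBB : B (B φ) = 0 := by
    have := congrArg (fun S : E →L[ℂ] E => S φ) hBA
    simpa [mul_apply_eq_comp, hAφ] using this
  have hBφ : B φ = 0 := by
    have hBs : IsSelfAdjoint B := cfc_predicate _ T
    have : ⟪B φ, B φ⟫_ℂ = ⟪φ, B (B φ)⟫_ℂ := hBs.isSymmetric φ (B φ)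
    rw [hBB, inner_zero_right] at this
    exact inner_self_eq_zero.1 this
  have hBT : B = T - algebraMap ℝ (E →L[ℂ] E) lam := by
    rw [hB, cfc_sub (fun x : ℝ => x) (fun _ => lam) T continuousOn_id continuousOn_const, cfc_const lam T]
    congr 1
    exact cfc_id' ℝ T
  rw [hBT, sub_apply, Algebra.algebraMap_eq_smul_one, smul_apply, one_apply_eq_self,
    sub_eq_zero] at hBφ
  rw [hBφ, Complex.coe_smul]

end SpectralMeasures

namespace WeightedGraph

/-! ### The density of states and its consequences for the spectrum -/

section TraceFormula

variable {V : Type*} {d ν : ℕ} [AddAction (Fin d → ℤ) V] {Γ : WeightedGraph V}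

-- By Fourier inversion the diagonal entry of the `n`-th power at `v i` is the mean over the cell of
-- the `i`-th diagonal entry of the `n`-th power of the Floquet matrix; summing over `i` produces
-- the trace.
open Classical in
theorem trace_pow_schrodingerOp (hΓ : Γ.IsCrystal d) {v : Fin ν → V}
    (hv : IsFundamentalCell (d := d) v) (a : Fin d → ℝ) (n : ℕ) :
    ∑ i, (schrodingerOp hΓ ^ n) (lp.single 2 (v i) (1 : ℂ)) (v i)
      = ((∫ θ, ∑ j, floquetEigenvalue hΓ v j θ ^ n ∂cellMeasure a : ℝ) : ℂ) := by
  have h := fun i => integral_bloch hΓ v (schrodingerOp_pow_single hΓ hv i n).1 a i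
  rw [← integral_complex_ofReal]
  simp only [← trace_pow_floquetMatrix, Matrix.trace, Matrix.diag]
  rw [Finset.sum_congr rfl fun i _ => (h i).2.symm, ← integral_finsetSum _ fun i _ => (h i).1]
  refine integral_congr_ae (Filter.Eventually.of_forall fun θ => Finset.sum_congr rfl fun i _ => ?_)
  rw [(schrodingerOp_pow_single hΓ hv i n).2]
  simp

open Classical in
/-- The density of states formula: the spectral measures at the vertices of a fundamental cell add
up to the sum of the distributions of the Floquet eigenvalues. -/
theorem sum_spectralMeasure_single (hΓ : Γ.IsCrystal d) {v : Fin ν → V}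
    (hv : IsFundamentalCell (d := d) v) (hE : ∀ j, Continuous (floquetEigenvalue hΓ v j))
    (a : Fin d → ℝ) {μ : Fin ν → Measure ℝ}
    (hμ : ∀ i, IsSpectralMeasure (schrodingerOp hΓ) (lp.single 2 (v i) (1 : ℂ)) (μ i)) :
    ∑ i, μ i = ∑ j, (cellMeasure a).map (floquetEigenvalue hΓ v j) := by
  obtain ⟨K, hK, hKa⟩ := exists_isCompact_ae_mem_cellMeasure a
  obtain ⟨C, hC⟩ := hK.exists_bound_of_continuousOn
    (continuous_pi hE : Continuous fun θ j => floquetEigenvalue hΓ v j θ).continuousOn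
  refine sum_spectralMeasure_eq_sum_map (schrodingerOp_isSelfAdjoint hΓ) hμ
    (fun j => (hE j).measurable) (C := C)
    (hKa.mono fun θ hθ j => (norm_le_pi_norm (fun j => floquetEigenvalue hΓ v j θ) j).trans
      (hC θ hθ)) fun n => ?_
  rw [← trace_pow_schrodingerOp hΓ hv a n]
  refine Finset.sum_congr rfl fun i _ => ?_
  rw [lp.inner_single_left]
  simp

/-- A translate of a fundamental cell is a fundamental cell. -/
theorem IsFundamentalCell.vadd {v : Fin ν → V} (hv : IsFundamentalCell (d := d) v)
    (k : Fin d → ℤ) : IsFundamentalCell (d := d) fun i => k +ᵥ v i := by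
  have : (fun p : Fin ν × (Fin d → ℤ) => p.2 +ᵥ (k +ᵥ v p.1))
      = (fun p : Fin ν × (Fin d → ℤ) => p.2 +ᵥ v p.1) ∘
        ((Equiv.refl (Fin ν)).prodCongr (Equiv.addRight k)) := by
    ext p
    simp [vadd_vadd]
  rw [IsFundamentalCell, this]
  exact hv.comp (Equiv.bijective _)

/-- A translate of a fundamental cell has the same Floquet matrix. -/
theorem floquetMatrix_vadd (hΓ : Γ.IsCrystal d) (v : Fin ν → V) (k : Fin d → ℤ)
    (θ : EuclideanSpace ℝ (Fin d)) :
    Γ.floquetMatrix (fun i => k +ᵥ v i) θ = Γ.floquetMatrix v θ := by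
  ext i j
  simp only [floquetMatrix, Matrix.of_apply, hΓ.Q_inv]
  congr 1
  refine tsum_congr fun l => ?_
  rw [vadd_comm l k, hΓ.w_inv]

theorem floquetEigenvalue_vadd (hΓ : Γ.IsCrystal d) (v : Fin ν → V) (k : Fin d → ℤ) (j : Fin ν) :
    floquetEigenvalue hΓ (fun i => k +ᵥ v i) j = floquetEigenvalue hΓ v j := by
  ext θ
  have : ∀ {A B : Matrix (Fin ν) (Fin ν) ℂ} (hA : A.IsHermitian) (hB : B.IsHermitian), A = B →
      hA.eigenvalues₀ = hB.eigenvalues₀ := by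
    rintro A _ hA hB rfl
    rfl
  exact congrFun (this _ _ (floquetMatrix_vadd hΓ v k θ)) _

open Classical in
/-- Delta functions have absolutely continuous spectral measures if the Floquet eigenvalues pull
null sets back to null sets. -/
theorem isACVector_single (hΓ : Γ.IsCrystal d) {v : Fin ν → V}
    (hv : IsFundamentalCell (d := d) v) (hE : ∀ j, Continuous (floquetEigenvalue hΓ v j))
    (hnull : ∀ j, ∀ N : Set ℝ, volume N = 0 → volume (floquetEigenvalue hΓ v j ⁻¹' N) = 0)
    (x : V) : IsACVector (schrodingerOp hΓ) (lp.single 2 x (1 : ℂ)) := by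
  -- The translate by `k` of the cell contains `x` and has the same Floquet eigenvalues, so the
  -- spectral measure at `x` is one nonnegative summand of the density of states.
  obtain ⟨⟨i, k⟩, rfl⟩ := hv.2 x
  choose μ hμ using fun i => (schrodingerOp_isSelfAdjoint hΓ).exists_isSpectralMeasure
    (lp.single 2 (k +ᵥ v i) (1 : ℂ))
  refine ⟨μ i, hμ i, ?_⟩
  have hsum := sum_spectralMeasure_single hΓ (hv.vadd k)
    (fun j => by rw [floquetEigenvalue_vadd]; exact hE j) 0 hμ
  refine Measure.AbsolutelyContinuous.mk fun N hNm hN => ?_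
  have h0 : (∑ i, μ i) N = 0 := by
    rw [hsum, Measure.finsetSum_apply]
    refine Finset.sum_eq_zero fun j _ => ?_
    rw [floquetEigenvalue_vadd, Measure.map_apply (hE j).measurable hNm]
    exact cellMeasure_absolutelyContinuous 0 (hnull j N hN)
  rw [Measure.finsetSum_apply, Finset.sum_eq_zero_iff] at h0
  exact h0 i (Finset.mem_univ i)

/-- The deltas span a dense subspace, and the absolutely continuous vectors form a closed one. -/
theorem hasPurelyACSpectrum_schrodingerOp (hΓ : Γ.IsCrystal d) {v : Fin ν → V}
    (hv : IsFundamentalCell (d := d) v) (hE : ∀ j, Continuous (floquetEigenvalue hΓ v j))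
    (hnull : ∀ j, ∀ N : Set ℝ, volume N = 0 → volume (floquetEigenvalue hΓ v j ⁻¹' N) = 0) :
    HasPurelyACSpectrum (schrodingerOp hΓ) := by
  classical
  have hT := schrodingerOp_isSelfAdjoint hΓ
  refine ⟨hT, fun ψ => IsACVector.of_forall_dist_lt hT fun ε hε => ?_⟩
  have hs : HasSum (fun x => (lp.single 2 x (ψ x) : EllTwo V)) ψ :=
    lp.hasSum_single ENNReal.ofNat_ne_top ψ
  obtain ⟨s, hs⟩ := (Metric.tendsto_nhds.1 hs ε hε).exists
  refine ⟨_, IsACVector.sum hT s fun x _ => ?_, by rwa [dist_comm, dist_eq_norm] at hs⟩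
  have : (lp.single 2 x (ψ x) : EllTwo V) = ψ x • lp.single 2 x (1 : ℂ) := by
    rw [← lp.single_smul, smul_eq_mul, mul_one]
  rw [this]
  exact (isACVector_single hΓ hv hE hnull x).smul hT _

open Classical in
/-- A Floquet eigenvalue which is constant on an open set is an eigenvalue of the Schrödinger
operator. -/
theorem exists_eigenvector_of_floquetEigenvalue_eq (hΓ : Γ.IsCrystal d) {v : Fin ν → V}
    (hv : IsFundamentalCell (d := d) v) (hE : ∀ j, Continuous (floquetEigenvalue hΓ v j))
    {j : Fin ν} {a : EuclideanSpace ℝ (Fin d)} {r lam : ℝ} (hr : 0 < r)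
    (hlam : ∀ θ ∈ Metric.ball a r, floquetEigenvalue hΓ v j θ = lam) :
    ∃ φ : EllTwo V, φ ≠ 0 ∧ schrodingerOp hΓ φ = (lam : ℂ) • φ := by
  have hT := schrodingerOp_isSelfAdjoint hΓ
  choose μ hμ using fun i => hT.exists_isSpectralMeasure (lp.single 2 (v i) (1 : ℂ))
  have hsum := sum_spectralMeasure_single hΓ hv hE (fun i => a i) hμ
  -- The law of `E j` charges `lam`, because the cell with corner `a` meets the ball in positive
  -- measure.
  have hpos : (∑ i, μ i) {lam} ≠ 0 := by
    rw [hsum, Measure.finsetSum_apply]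
    intro h0
    have := Finset.sum_eq_zero_iff.1 h0 j (Finset.mem_univ j)
    rw [Measure.map_apply (hE j).measurable (measurableSet_singleton lam)] at this
    exact (cellMeasure_ball_pos a hr).ne' (measure_mono_null (fun θ hθ => hlam θ hθ) this)
  rw [Measure.finsetSum_apply] at hpos
  obtain ⟨i, _, hi⟩ := Finset.exists_ne_zero_of_sum_ne_zero hpos
  exact (hμ i).exists_apply_eq_smul hT hi

/-! ### Translations and infinite multiplicity -/

/-- Translation by `k` on `ℓ²(V)`. -/
def translation (k : Fin d → ℤ) : EllTwo V →ₗ[ℂ] EllTwo V where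
  toFun ψ := ⟨fun x => ψ (k +ᵥ x), by
    have h := (lp.memℓp ψ).summable (by norm_num)
    exact memℓp_gen (h.comp_injective (AddAction.injective k))⟩
  map_add' _ _ := rfl
  map_smul' _ _ := rfl

theorem translation_apply (k : Fin d → ℤ) (ψ : EllTwo V) (x : V) :
    translation k ψ x = ψ (k +ᵥ x) := rfl

theorem schrodingerOp_translation (hΓ : Γ.IsCrystal d) (k : Fin d → ℤ) (ψ : EllTwo V) :
    schrodingerOp hΓ (translation k ψ) = translation k (schrodingerOp hΓ ψ) := by
  ext x
  rw [translation_apply, schrodingerOp_apply, schrodingerOp_apply, translation_apply, hΓ.Q_inv,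
    ← (AddAction.toPerm k).tsum_eq fun y => (Γ.w (k +ᵥ x) y : ℂ) * ψ y]
  simp [translation_apply, hΓ.w_inv]

/-- Translations have no eigenvectors in `ℓ²(V)`. -/
theorem eq_zero_of_translation_eq_smul (hΓ : Γ.IsCrystal d) {k : Fin d → ℤ} (hk : k ≠ 0)
    {ψ : EllTwo V} {z : ℂ} (h : translation k ψ = z • ψ) : ψ = 0 := by
  have hstep : ∀ x, ψ (k +ᵥ x) = z * ψ x := fun x => by
    rw [← translation_apply, h]
    rfl
  ext x
  by_contra hx
  change ψ x ≠ 0 at hx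
  have hz : z ≠ 0 := by
    rintro rfl
    have := hstep (-k +ᵥ x)
    rw [vadd_neg_vadd, zero_mul] at this
    exact hx this
  -- Along the infinite orbit of `x` under `k` the values are geometric, hence bounded away from
  -- zero in one direction, against square summability.
  have hpow : ∀ n : ℤ, ψ ((n • k) +ᵥ x) = z ^ n * ψ x := by
    intro n
    induction n with
    | zero => simp
    | succ n ih =>
      rw [add_smul, one_smul, add_comm, add_vadd, hstep, ih, zpow_add_one₀ hz]
      ring
    | pred n ih =>
      have := hstep ((-(n : ℤ) - 1) • k +ᵥ x)
      rw [vadd_vadd, ← one_smul ℤ k, smul_smul, mul_one, ← add_smul, add_sub_cancel,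
        ih] at this
      rw [zpow_sub_one₀ hz]
      field_simp
      linear_combination -this
  have hinj : Function.Injective fun n : ℤ => (n • k) +ᵥ x :=
    (vadd_injective hΓ x).comp (smul_left_injective ℤ hk)
  have hsum : Summable fun n : ℤ => ‖ψ ((n • k) +ᵥ x)‖ ^ (2 : ℝ) := by
    have h := (lp.memℓp ψ).summable (by norm_num)
    simpa [Function.comp_def] using h.comp_injective hinj
  have hle : ∀ n : ℤ, 1 ≤ ‖z‖ ^ n → ‖ψ x‖ ^ (2 : ℝ) ≤ ‖ψ ((n • k) +ᵥ x)‖ ^ (2 : ℝ) := by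
    intro n hn
    rw [hpow, norm_mul, norm_zpow]
    exact Real.rpow_le_rpow (norm_nonneg _) (le_mul_of_one_le_left (norm_nonneg _) hn) zero_le_two
  have hpos : 0 < ‖ψ x‖ ^ (2 : ℝ) := Real.rpow_pos_of_pos (norm_pos_iff.2 hx) _
  have hcontra : ∀ g : ℕ → ℤ, Function.Injective g → (∀ n, 1 ≤ ‖z‖ ^ g n) → False := by
    intro g hg hgz
    have := (hsum.comp_injective hg).tendsto_atTop_zero
    exact absurd (ge_of_tendsto' this fun n => hle _ (hgz n)) (not_le.2 hpos)
  rcases le_total 1 ‖z‖ with h1 | h1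
  · refine hcontra (fun n => n) Nat.cast_injective fun n => ?_
    rw [zpow_natCast]
    exact one_le_pow₀ h1
  · refine hcontra (fun n => -n) (neg_injective.comp Nat.cast_injective) fun n => ?_
    rw [zpow_neg, zpow_natCast]
    exact (one_le_inv₀ (pow_pos (norm_pos_iff.2 hz) n)).2 (pow_le_one₀ (norm_nonneg _) h1)

/-- Every eigenvalue of the Schrödinger operator of a crystal is infinitely degenerate. -/
theorem isInfinitelyDegenerateEigenvalue_of_eigenvector (hΓ : Γ.IsCrystal d) {lam : ℝ}
    {φ : EllTwo V} (hφ : φ ≠ 0) (h : schrodingerOp hΓ φ = (lam : ℂ) • φ) :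
    IsInfinitelyDegenerateEigenvalue (schrodingerOp hΓ) lam := by
  have hmem : φ ∈ Module.End.eigenspace (schrodingerOp hΓ : EllTwo V →ₗ[ℂ] EllTwo V) (lam : ℂ) :=
    Module.End.mem_eigenspace_iff.2 h
  refine ⟨Module.End.hasEigenvalue_of_hasEigenvector ⟨hmem, hφ⟩, fun hfin => ?_⟩
  set W := Module.End.eigenspace (schrodingerOp hΓ : EllTwo V →ₗ[ℂ] EllTwo V) (lam : ℂ) with hW
  let k : Fin d → ℤ := fun _ => 1
  have hk : k ≠ 0 := fun h0 => one_ne_zero (congrFun h0 ⟨0, hΓ.dim_pos⟩)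
  have hinv : ∀ ψ ∈ W, translation k ψ ∈ W := by
    intro ψ hψ
    have hψ' : schrodingerOp hΓ ψ = (lam : ℂ) • ψ := Module.End.mem_eigenspace_iff.1 hψ
    refine Module.End.mem_eigenspace_iff.2 ?_
    change schrodingerOp hΓ (translation k ψ) = _
    rw [schrodingerOp_translation, hψ', map_smul]
  have : Nontrivial W := ⟨⟨φ, hmem⟩, 0, fun h0 => hφ (congrArg Subtype.val h0)⟩
  -- An endomorphism of a nonzero finite-dimensional complex space has an eigenvalue; here this
  -- contradicts `eq_zero_of_translation_eq_smul`.
  obtain ⟨z, hz⟩ := Module.End.exists_eigenvalue ((translation k).restrict hinv)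
  obtain ⟨ψ, hψ, hψ0⟩ := hz.exists_hasEigenvector
  refine hψ0 (Subtype.ext (eq_zero_of_translation_eq_smul hΓ hk (z := z) ?_))
  exact congrArg Subtype.val (Module.End.mem_eigenspace_iff.1 hψ)

end TraceFormula

end WeightedGraph

end

theorem theorem5p3 {d ν : ℕ} {V : Type*} [AddAction (Fin d → ℤ) V]
    (Γ : WeightedGraph V) (hΓ : Γ.IsCrystal d)
    (v : Fin ν → V) (hv : WeightedGraph.IsFundamentalCell (d := d) v)
    (hLip : ∀ j : Fin ν, ∃ C : NNReal, LipschitzWith C (WeightedGraph.floquetEigenvalue hΓ v j)) :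
    ((∀ j : Fin ν, ∀ᵐ θ ∂(volume : Measure (EuclideanSpace ℝ (Fin d))),
        ∃ g : EuclideanSpace ℝ (Fin d), g ≠ 0 ∧
          HasGradientAt (WeightedGraph.floquetEigenvalue hΓ v j) g θ) →
      HasPurelyACSpectrum (WeightedGraph.schrodingerOp hΓ)) ∧
    ((∃ (j : Fin ν) (S : Set (EuclideanSpace ℝ (Fin d))), IsOpen S ∧ S.Nonempty ∧
        ∀ᵐ θ ∂(volume : Measure (EuclideanSpace ℝ (Fin d))), θ ∈ S →
          HasGradientAt (WeightedGraph.floquetEigenvalue hΓ v j) 0 θ) →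
      ∃ lam : ℝ, IsInfinitelyDegenerateEigenvalue (WeightedGraph.schrodingerOp hΓ) lam) := by
  have hE : ∀ j, Continuous (WeightedGraph.floquetEigenvalue hΓ v j) := fun j =>
    (hLip j).choose_spec.continuous
  refine ⟨fun hgrad => ?_, ?_⟩
  · exact WeightedGraph.hasPurelyACSpectrum_schrodingerOp hΓ hv hE fun j N hN =>
      volume_preimage_eq_zero_of_ae_gradient_ne_zero (hE j) (hgrad j) hN
  · rintro ⟨j, S, hS, ⟨a, ha⟩, hgrad⟩
    obtain ⟨r, hr, hball⟩ := Metric.isOpen_iff.1 hS a ha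
    obtain ⟨C, hC⟩ := hLip j
    obtain ⟨φ, hφ, h⟩ := WeightedGraph.exists_eigenvector_of_floquetEigenvalue_eq hΓ hv hE
      (half_pos hr) fun θ hθ => eq_of_ae_gradient_eq_zero hC hball hgrad hθ
    exact ⟨_, WeightedGraph.isInfinitelyDegenerateEigenvalue_of_eigenvector hΓ hφ h⟩
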